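/- **Setting.** Let $G$ be a finite simple graph with a component tree: a finite tree $S$ whose nodes $N$ (components) carry vertex sets $B_N$ covering $V(G)$, such that for each vertex the nodes containing it induce a connected part of $S$; every (real) edge of $G$ is assigned to exactly one component, which contains both of its ends; for adjacent $N,M$ the separating set $B_N\cap B_M$ has $2$ or $3$ elements; and in each component every vertex lies in at most one of its separating sets (so a separating set is shared by only two components). The component $N$ is regarded as the multigraph on $B_N$ formed by its real edges together with a virtual edge for each separating pair and a virtual triangle for each separating triplet of $N$. Each component is either *planar*, i.e. it is connected and given with a planar embedding in which every virtual triangle bounds a face, which is not the outer face, or *constant sized*, i.e. it has at most $m$ real edges. Let $K$ be an integer with $K>\max(2^{m+2},7)$. **Working tree.** Let $\mathcal T$ be a working tree of $S$: a rooted tree on the nodes of $S$ obtained by choosing any node $c$ of $S$ as the root, and attaching to $c$ as subtrees working trees, built recursively in the same way, of the components of $S-c$. The root has level $1$, and a child has level one more than its parent; the height is $h(N)=L+1-\mathrm{level}(N)$, where $L$ is the maximal level. Let $T_N$ be the subtree of $\mathcal T$ rooted at $N$, and $l(N)$ its number of leaves. **Weighting.** A weighting $w_0$ is a skew-symmetric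 integer function on the directed edges of $G$ such that the following holds, where virtual edges have weight $0$. - In a constant sized component $N$ with real edges $e_1,\dots,e_r$, in some order, $e_j$ has weight $2^jK^{h(N)-1}l(N)$ in one of its directions. - In a planar component $N$, if $N$ is a leaf of $\mathcal T$, all weights are $0$. Otherwise every inner face $f$ has clockwise circulation $\sum_R 2K^{h(R)}l(R)$, summed over those children $R$ of $N$ in $\mathcal T$ for which $f$ is adjacent to the virtual edge or triangle of $N$ at which $T_R$ is attached, i.e. the one shared with the neighbour of $N$ in $S$ that belongs to $T_R$. The face bounded by a virtual triangle itself is not regarded as adjacent to that triangle. **Projection.** For a cycle $C$ of $G$, the projection of $C$ on $N$ consists of the real edges of $C$ belonging to $N$, completed to a cycle by replacing each maximal part of $C$ outside $N$ with the virtual edge joining its ends; it is empty if $C$ has no edge in $N$. **Statement.** Such a weighting $w_0$ exists, and for every such $w_0$, every cycle $C$ of $G$ whose projection is nonempty on at least two components has nonzero circulation, i.e. the sum of $w_0$ over the edges of $C$, directed along $C$, is nonzero. -/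

import Mathlib

/-! ### Component trees -/

/-- A component tree of the graph `G`, i.e. a decomposition of `G` by clique-sums along separating
pairs and triplets, in which a vertex of a component lies in at most one separating set of that
component.  `bag N` is the vertex set of the component `N`; adjacent components share
exactly the separating set `bag N ∩ bag M`; `home e` is the only component that contains the
real edge `e`. -/
structure ComponentTree {V : Type*} (G : SimpleGraph V) (ι : Type*) where
  tree : SimpleGraph ι
  isTree : tree.IsTree
  bag : ι → Set V
  bag_cover : ∀ v : V, ∃ N, v ∈ bag N
  /-- components meet only in the separating sets along the tree -/
  bag_connected : ∀ v : V, (tree.induce {N | v ∈ bag N}).Preconnected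
  home : G.edgeSet → ι
  home_mem : ∀ (e : G.edgeSet), ∀ v ∈ (e : Sym2 V), v ∈ bag (home e)
  /-- separating sets are pairs or triplets -/
  sep_card : ∀ N M, tree.Adj N M → (bag N ∩ bag M).ncard = 2 ∨ (bag N ∩ bag M).ncard = 3
  /-- in a component, a vertex is part of at most one separating set (in particular a separating
  set is shared by only two components) -/
  sep_disjoint : ∀ N M M', tree.Adj N M → tree.Adj N M' → M ≠ M' →
    Disjoint (bag N ∩ bag M) (bag N ∩ bag M')

namespace ComponentTree

variable {V ι : Type*} {G : SimpleGraph V} (D : ComponentTree G ι)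

/-- The separating set shared by the (adjacent) components `N` and `M`. -/
def sep (N M : ι) : Set V := D.bag N ∩ D.bag M

/-- The component to which the real edge underlying the dart `d` belongs. -/
def dartHome (d : G.Dart) : ι := D.home ⟨d.edge, d.edge_mem⟩

/-- The (undirected) real edges of the component `N`. -/
abbrev RealEdge (N : ι) : Type _ := {e : G.edgeSet // D.home e = N}

/-- The real edges of the component `N`, in both directions. -/
abbrev RealDart (N : ι) : Type _ := {d : G.Dart // D.dartHome d = N}

/-- The virtual edges of the component `N`, in both directions: every separating set `sep N M`
of `N` carries a virtual clique.  The element `(M, u, v)` is the virtual edge from `u` to `v`. -/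
abbrev VirtualDart (N : ι) : Type _ :=
  {x : ι × V × V // D.tree.Adj N x.1 ∧ x.2.1 ∈ D.sep N x.1 ∧ x.2.2 ∈ D.sep N x.1 ∧ x.2.1 ≠ x.2.2}

/-- The directed edges of the component `N`, a multigraph: a real edge may be parallel to a
virtual one. -/
abbrev CDart (N : ι) : Type _ := D.RealDart N ⊕ D.VirtualDart N

variable {D} {N : ι}

/-- The initial vertex of a directed edge of a component. -/
def CDart.tail : D.CDart N → V
  | .inl d => d.1.fst
  | .inr x => x.1.2.1

/-- The final vertex of a directed edge of a component. -/
def CDart.head : D.CDart N → V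
  | .inl d => d.1.snd
  | .inr x => x.1.2.2

/-- `d` is a virtual edge of the separating set shared with `M`. -/
def CDart.IsVirtualAt (M : ι) : D.CDart N → Prop
  | .inl _ => False
  | .inr x => x.1.1 = M

theorem dartHome_symm (D : ComponentTree G ι) (d : G.Dart) :
    D.dartHome d.symm = D.dartHome d := by
  unfold dartHome
  congr 1
  exact Subtype.ext d.edge_symm

/-- The same edge in the opposite direction. -/
def CDart.rev : D.CDart N → D.CDart N
  | .inl d => .inl ⟨d.1.symm, (D.dartHome_symm d.1).trans d.2⟩
  | .inr x => .inr ⟨(x.1.1, x.1.2.2, x.1.2.1), x.2.1, x.2.2.2.1, x.2.2.1, x.2.2.2.2.symm⟩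

theorem CDart.rev_rev (d : D.CDart N) : CDart.rev (CDart.rev d) = d := by
  rcases d with d | x <;> simp [CDart.rev]

/-- A weight function on the directed edges of `G`, on the directed edges of a component:
virtual edges have weight zero. -/
def CDart.weight (w : G.Dart → ℤ) : D.CDart N → ℤ
  | .inl d => w d.1
  | .inr _ => 0

variable (D N)

/-- Reversal of directed edges as a permutation. -/
def revPerm : Equiv.Perm (D.CDart N) := ⟨CDart.rev, CDart.rev, CDart.rev_rev, CDart.rev_rev⟩

/-- The permutation that walks along the faces, given the counterclockwise rotation `rot` of the
outgoing edges at every vertex: after traversing `d`, turn into the edge that follows the reverse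
of `d` in the rotation.  The face lies to the right, so that inner faces are traversed
clockwise. -/
def facePerm (rot : Equiv.Perm (D.CDart N)) : Equiv.Perm (D.CDart N) :=
  (D.revPerm N).trans rot

/-- The faces of a rotation system: the orbits of the face permutation. -/
abbrev RotFace (rot : Equiv.Perm (D.CDart N)) : Type _ :=
  Quotient (Equiv.Perm.SameCycle.setoid (D.facePerm N rot))

variable {D N}

/-- The face to the right of a directed edge. -/
def rotFace (rot : Equiv.Perm (D.CDart N)) (d : D.CDart N) : D.RotFace N rot :=
  Quotient.mk (Equiv.Perm.SameCycle.setoid (D.facePerm N rot)) d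

/-- `f` is a face bounded exactly by the virtual triangle shared with `M`. -/
def IsTriangleFace (rot : Equiv.Perm (D.CDart N)) (M : ι) (f : D.RotFace N rot) : Prop :=
  (D.sep N M).ncard = 3 ∧ {d | rotFace rot d = f}.ncard = 3 ∧
    ∀ d, rotFace rot d = f → CDart.IsVirtualAt M d

variable (D N)

/-- A planar embedding of the component `N` (a connected multigraph, with its virtual edges),
given combinatorially by a rotation system of genus zero, together with the choice of the outer
face.  Every virtual triangle is a face, and is not the outer one. -/
structure PlanarEmbedding where
  /-- counterclockwise cyclic order of the outgoing edges at every vertex -/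
  rot : Equiv.Perm (D.CDart N)
  rot_sameCycle : ∀ d e : D.CDart N, rot.SameCycle d e ↔ CDart.tail d = CDart.tail e
  connected : ∀ u ∈ D.bag N, ∀ v ∈ D.bag N,
    Relation.ReflTransGen (fun a b => ∃ d : D.CDart N, CDart.tail d = a ∧ CDart.head d = b) u v
  /-- Euler's formula `|V| - |E| + |F| = 2`, doubled; there are two darts for every edge -/
  euler : 2 * (D.bag N).ncard + 2 * Nat.card (D.RotFace N rot) = Nat.card (D.CDart N) + 4
  outer : D.RotFace N rot
  triangle_face : ∀ M, D.tree.Adj N M → (D.sep N M).ncard = 3 → ∃ f, IsTriangleFace rot M f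
  outer_not_triangle : ∀ M, D.tree.Adj N M → ¬ IsTriangleFace rot M outer

namespace PlanarEmbedding

variable {D N}

/-- The faces of an embedding. -/
abbrev Face (E : D.PlanarEmbedding N) : Type _ := D.RotFace N E.rot

/-- The face to the right of a directed edge. -/
def face (E : D.PlanarEmbedding N) (d : D.CDart N) : E.Face := rotFace E.rot d

/-- The face `f` is adjacent to the virtual edge or virtual triangle shared with `M` (the
virtual triangle itself does not count). -/
def AdjacentTo (E : D.PlanarEmbedding N) (f : E.Face) (M : ι) : Prop :=
  (∃ d, CDart.IsVirtualAt M d ∧ E.face d = f) ∧ ¬ IsTriangleFace E.rot M f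

open Classical in
/-- The circulation of a face: the sum of the weights along its boundary walk (clockwise, for an
inner face). -/
noncomputable def faceCirculation [Fintype V] [Fintype ι] (E : D.PlanarEmbedding N)
    (w : G.Dart → ℤ) (f : E.Face) : ℤ :=
  ∑ d : D.CDart N, if E.face d = f then CDart.weight w d else 0

end PlanarEmbedding

end ComponentTree

/-! ### Working trees -/

namespace WorkingTree

variable {ι : Type*}

/-- The rooted forest `par` (a node is sent to its parent) restricted to the node set `X` is a
working tree of the subtree of `S` on `X`, and its root has parent `p`: a center `c` of `X` is the
root, and every connected component of `X ∖ {c}` carries a working tree attached to `c`.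
Any choice of the centers is allowed. -/
inductive IsWorkingTreeOn (S : SimpleGraph ι) (par : ι → Option ι) : Option ι → Set ι → Prop
  | mk (p : Option ι) (X : Set ι) (c : ι) (hc : c ∈ X) (hp : par c = p)
      (h : ∀ K : (S.induce (X \ {c})).ConnectedComponent,
        IsWorkingTreeOn S par (some c) (Subtype.val '' K.supp)) :
      IsWorkingTreeOn S par p X

/-- `par` is the parent function of a working tree of the tree `S`. -/
def IsWorkingTree (S : SimpleGraph ι) (par : ι → Option ι) : Prop :=
  IsWorkingTreeOn S par none Set.univ

variable (par : ι → Option ι)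

/-- `a` is `b` or a descendant of `b`. -/
def Descends (a b : ι) : Prop := Relation.ReflTransGen (fun x y => par x = some y) a b

/-- The level of a node: the root has level one. -/
noncomputable def level (N : ι) : ℕ := {a | Descends par N a}.ncard

/-- The height of a node: `L + 1` minus its level, where `L` is the maximal level. -/
noncomputable def height [Fintype ι] (N : ι) : ℕ :=
  Finset.univ.sup (level par) + 1 - level par N

/-- The number of leaves of the subtree with root `N`. -/
noncomputable def leaves (N : ι) : ℕ := {a | Descends par a N ∧ ∀ x, par x ≠ some a}.ncard

end WorkingTree

/-! ### The weight function -/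

namespace ComponentTree

variable {V ι : Type*} {G : SimpleGraph V} (D : ComponentTree G ι)

/-- Skew-symmetric weight functions on the directed edges of `G`. -/
def IsSkew (w : G.Dart → ℤ) : Prop := ∀ d, w d.symm = - w d

open Classical in
/-- The circulation prescribed for an inner face `f` of a planar component `N`: the sum,
over the subtrees attached to `N` in the working tree (with roots `R`) whose separating set in `N`
is adjacent to `f`, of `2 * K ^ h(R) * l(R)`. -/
noncomputable def targetCirculation [Fintype ι] (par : ι → Option ι) (K : ℕ) {N : ι}
    (E : D.PlanarEmbedding N) (f : E.Face) : ℤ :=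
  ∑ R : ι, if par R = some N ∧
      ∃ M, D.tree.Adj N M ∧ WorkingTree.Descends par M R ∧ E.AdjacentTo f M
    then 2 * (K : ℤ) ^ WorkingTree.height par R * (WorkingTree.leaves par R : ℤ) else 0

/-- `w` is a weight function `w₀`, for the working tree `par`, the constant `K` and the
given embeddings; a component `N` with `emb N = none` is treated as a constant sized one. -/
structure IsWeightZero [Fintype V] [Fintype ι] (par : ι → Option ι) (K : ℕ)
    (emb : ∀ N, Option (D.PlanarEmbedding N)) (w : G.Dart → ℤ) : Prop where
  skew : IsSkew w
  /-- planar components: all inner faces have the prescribed circulations -/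
  planar : ∀ N E, emb N = some E → ∀ f : E.Face, f ≠ E.outer →
    E.faceCirculation w f = D.targetCirculation par K E f
  /-- planar components that are leaves of the working tree: all weights are zero -/
  planar_leaf : ∀ N, emb N ≠ none → (∀ R, par R ≠ some N) → ∀ d, D.dartHome d = N → w d = 0
  /-- constant sized components: the `j`-th real edge, `j = 1, 2, …`, has
  weight `2 ^ j * K ^ (h(N) - 1) * l(N)` in one of its two directions -/
  const : ∀ N, emb N = none →
    ∃ idx : D.RealEdge N ≃ Fin (Nat.card (D.RealEdge N)),
      ∀ (d : G.Dart) (hd : D.dartHome d = N),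
        |w d| = 2 ^ ((idx ⟨⟨d.edge, d.edge_mem⟩, hd⟩ : ℕ) + 1) *
          (K : ℤ) ^ (WorkingTree.height par N - 1) * (WorkingTree.leaves par N : ℤ)

/-! ### Cycles -/

/-- The circulation of a closed walk: the sum of the weights of its directed edges. -/
def circulation (w : G.Dart → ℤ) {u : V} (C : G.Walk u u) : ℤ := (C.darts.map w).sum

open Classical in
/-- The directed edges of `C` that lie in the component `N`, in the order of `C`. -/
noncomputable def fragment {u : V} (C : G.Walk u u) (N : ι) : List G.Dart :=
  C.darts.filter (fun d => D.dartHome d = N)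

open Classical in
/-- The projection of a cycle `C` on the component `N`, as the list of its directed edges:
the real edges of `C` in `N`, completed to a cycle by virtual edges.  Every maximal part
of `C` outside `N`, which leaves `N` and comes back at vertices of a separating
set, is replaced by the virtual edge joining its two ends.
Real edges are tagged `Sum.inl`, virtual ones `Sum.inr`. -/
noncomputable def projection {u : V} (C : G.Walk u u) (N : ι) : List (G.Dart ⊕ (V × V)) :=
  ((D.fragment C N).zip ((D.fragment C N).rotate 1)).flatMap fun x =>
    if x.1.snd = x.2.fst then [Sum.inl x.1] else [Sum.inl x.1, Sum.inr (x.1.snd, x.2.fst)]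

end ComponentTree

/-! The weights separate the scales of the working tree. Put `B(N) = K^h(N) * l(N)`
(`subtreeBound`). The height drops by one from a node to its children and the leaf sets of the
children are disjoint, so the bounds of the children of `N` add up to at most `c = B(N)/K`.
Inductively, the part of the circulation lying in `T_N` is smaller than `B(N)` in absolute value
(`abs_subtreeSum_lt`).

Among the components met by a cycle there is one, `N`, that has all the others below it in the
working tree (`exists_top`): a cycle stays on one side of every component that it does not meet, so
a center outside the cycle never splits it. It remains to see that the contribution of `N` itself
exceeds that of its subtrees. If `N` is constant sized, a signed sum of distinct powers of two gives
at least `2c`. If `N` is planar, the projection of the cycle encloses a set `A` of inner faces, and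
the contribution is, up to sign, the sum of the prescribed circulations over `A`. These are
nonnegative, so nothing cancels, and every child subtree entered by the cycle is adjacent to a face
of `A`; this gives at least twice the sum of the bounds of those children. Conversely a separating
set is adjacent to at most three faces, whence the upper bound `6c` used in the induction.

Planarity enters through linear algebra over `ZMod 2`: in genus zero, Euler's formula forces every
even edge set to be the boundary of a set of faces (`exists_coboundary_eq`). The projection is
encoded by the places where the cycle crosses separating sets (`entry`), and is even. The signs come
from the integral boundary of `A`: it is a conserved flow supported on the projection, hence
constant along the cycle (`exists_flow_eq`), with value `1` or `-1`.

For the existence of the weights, one unit on a real edge moves circulation between its two faces,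
so it suffices to reach every face other than the virtual triangles from the outer face across real
edges (`reflTransGen_outer`). The indicator of the reachable faces has a coboundary that is a flow
on the virtual edges alone. These form vertex-disjoint single edges and triangles, so the flow can
at most run around triangles; it distinguishes no face from the outer one except possibly the
triangles. -/

/-! ### Vertices joined inside a set -/

namespace SimpleGraph

variable {ι : Type*} {S : SimpleGraph ι} {X Y : Set ι} {a b c : ι}

/-- `a` and `b` are joined by a walk all of whose vertices lie in `X`. -/
def JoinedIn (S : SimpleGraph ι) (X : Set ι) (a b : ι) : Prop :=
  ∃ p : S.Walk a b, ∀ x ∈ p.support, x ∈ X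

namespace JoinedIn

theorem refl (h : a ∈ X) : S.JoinedIn X a a := ⟨.nil, by simpa using h⟩

theorem symm (h : S.JoinedIn X a b) : S.JoinedIn X b a := by
  obtain ⟨p, hp⟩ := h
  exact ⟨p.reverse, by simpa using hp⟩

theorem trans (h : S.JoinedIn X a b) (h' : S.JoinedIn X b c) : S.JoinedIn X a c := by
  obtain ⟨p, hp⟩ := h
  obtain ⟨q, hq⟩ := h'
  refine ⟨p.append q, fun x hx => ?_⟩
  rcases (Walk.mem_support_append_iff p q).1 hx with h | h
  exacts [hp x h, hq x h]

theorem mono (h : S.JoinedIn X a b) (hXY : X ⊆ Y) : S.JoinedIn Y a b := by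
  obtain ⟨p, hp⟩ := h
  exact ⟨p, fun x hx => hXY (hp x hx)⟩

theorem left_mem (h : S.JoinedIn X a b) : a ∈ X := by
  obtain ⟨p, hp⟩ := h
  exact hp a p.start_mem_support

theorem right_mem (h : S.JoinedIn X a b) : b ∈ X := h.symm.left_mem

theorem of_adj (h : S.Adj a b) (ha : a ∈ X) (hb : b ∈ X) : S.JoinedIn X a b :=
  ⟨h.toWalk, by simp [ha, hb]⟩

/-- A walk from a set `Y` to its complement crosses an edge between them. -/
theorem exists_exit (h : S.JoinedIn X a b) (ha : a ∈ Y) (hb : b ∉ Y) :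
    ∃ x y, S.Adj x y ∧ x ∈ X ∧ y ∈ X ∧ x ∈ Y ∧ y ∉ Y := by
  obtain ⟨p, hp⟩ := h
  obtain ⟨d, hd, h1, h2⟩ := p.exists_boundary_dart Y ha hb
  exact ⟨d.fst, d.snd, d.adj, hp _ (p.dart_fst_mem_support_of_mem_darts hd),
    hp _ (p.dart_snd_mem_support_of_mem_darts hd), h1, h2⟩

theorem of_reachable {a b : X} (h : (S.induce X).Reachable a b) : S.JoinedIn X a b := by
  obtain ⟨p⟩ := h
  refine ⟨p.map (Embedding.induce X).toHom, fun x hx => ?_⟩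
  replace hx : x ∈ p.support.map Subtype.val :=
    (Walk.support_map (Embedding.induce X).toHom p) ▸ hx
  rw [List.mem_map] at hx
  obtain ⟨y, -, rfl⟩ := hx
  exact y.2

theorem reachable (h : S.JoinedIn X a b) :
    (S.induce X).Reachable ⟨a, h.left_mem⟩ ⟨b, h.right_mem⟩ := by
  obtain ⟨p, hp⟩ := h
  exact ⟨p.induce X hp⟩

theorem exists_isPath (h : S.JoinedIn X a b) :
    ∃ p : S.Walk a b, p.IsPath ∧ ∀ x ∈ p.support, x ∈ X := by
  classical
  obtain ⟨p, hp⟩ := h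
  exact ⟨p.bypass, p.bypass_isPath, fun x hx => hp x (p.support_bypass_subset_support hx)⟩

/-- Paths in a forest are unique, so shortening the two walks to paths gives one path that lies in
both sets. -/
theorem inter (hS : S.IsAcyclic) (h : S.JoinedIn X a b) (h' : S.JoinedIn Y a b) :
    S.JoinedIn (X ∩ Y) a b := by
  obtain ⟨p, hp, hpX⟩ := h.exists_isPath
  obtain ⟨q, hq, hqY⟩ := h'.exists_isPath
  have : p = q := congrArg Subtype.val ((hS.subsingleton_path _ _).elim ⟨p, hp⟩ ⟨q, hq⟩)
  subst this
  exact ⟨p, fun x hx => ⟨hpX x hx, hqY x hx⟩⟩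

/-- Vertices joined off `c` and joined in `X` are joined in `X ∖ {c}`. -/
theorem diff_singleton (hS : S.IsAcyclic) (h : S.JoinedIn X a b) (h' : S.JoinedIn {c}ᶜ a b) :
    S.JoinedIn (X \ {c}) a b :=
  (h.inter hS h').mono fun _ hx => ⟨hx.1, hx.2⟩

/-- In a forest, two neighbours of `c` that are joined off `c` are equal. -/
theorem eq_of_adj (hS : S.IsAcyclic) (ha : S.Adj c a) (hb : S.Adj c b)
    (h : S.JoinedIn {c}ᶜ a b) : a = b := by
  by_contra hab
  have h1 : S.JoinedIn {a, c, b} a b :=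
    (of_adj (X := {a, c, b}) ha.symm (by simp) (by simp)).trans
      (of_adj hb (by simp) (by simp))
  obtain ⟨x, y, hxy, hx, hy, hxa, hya⟩ :=
    (h1.inter hS h).exists_exit (Y := {a}) rfl (by simpa using Ne.symm hab)
  obtain rfl : x = a := hxa
  have hy' : y = b := by
    rcases hy.1 with h | h | h
    exacts [absurd h hya, absurd h hy.2, h]
  subst hy'
  have hp : (Walk.cons ha (Walk.cons hxy Walk.nil)).IsPath := by
    simp [Walk.cons_isPath_iff, ha.ne, hb.ne, hxy.ne]
  have hq : (Walk.cons hb Walk.nil).IsPath := by simp [hb.ne]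
  have := congrArg (fun p : S.Path c y => p.1.length)
    ((hS.subsingleton_path _ _).elim ⟨_, hp⟩ ⟨_, hq⟩)
  simp at this

end JoinedIn

/-- Every vertex other than `c` is joined off `c` to a neighbour of `c`. -/
theorem Connected.exists_adj_joinedIn (hS : S.Connected) (h : a ≠ c) :
    ∃ b, S.Adj c b ∧ S.JoinedIn {c}ᶜ b a := by
  obtain ⟨p⟩ := hS.preconnected a c
  have hp : S.JoinedIn Set.univ a c := ⟨p, by simp⟩
  obtain ⟨x, y, hxy, -, -, hx, hy⟩ := hp.exists_exit (Y := {x | S.JoinedIn {c}ᶜ x a})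
    (JoinedIn.refl (by simpa using h)) (fun h' => h'.left_mem rfl)
  obtain rfl : y = c := by
    by_contra hyc
    exact hy ((JoinedIn.of_adj hxy.symm hyc hx.left_mem).trans hx)
  exact ⟨x, hxy.symm, hx⟩

theorem ConnectedComponent.joinedIn_supp (K : (S.induce X).ConnectedComponent)
    (ha : a ∈ Subtype.val '' K.supp) (hb : b ∈ Subtype.val '' K.supp) :
    S.JoinedIn (Subtype.val '' K.supp) a b := by
  obtain ⟨a, ha, rfl⟩ := ha
  obtain ⟨b, hb, rfl⟩ := hb
  have hab : (S.induce X).Reachable a b := ConnectedComponent.exact (ha.trans hb.symm)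
  obtain ⟨p⟩ := hab
  refine ⟨p.map (Embedding.induce X).toHom, fun x hx => ?_⟩
  replace hx : x ∈ p.support.map Subtype.val :=
    (Walk.support_map (Embedding.induce X).toHom p) ▸ hx
  rw [List.mem_map] at hx
  obtain ⟨y, hy, rfl⟩ := hx
  classical
  exact ⟨y, (ConnectedComponent.sound ⟨(p.takeUntil y hy).reverse⟩).trans ha, rfl⟩

theorem ConnectedComponent.mem_supp_of_joinedIn (K : (S.induce X).ConnectedComponent)
    (ha : a ∈ Subtype.val '' K.supp) (h : S.JoinedIn X a b) : b ∈ Subtype.val '' K.supp := by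
  obtain ⟨a, ha, rfl⟩ := ha
  exact ⟨⟨b, h.right_mem⟩, (ConnectedComponent.sound h.reachable.symm).trans ha, rfl⟩

end SimpleGraph

/-! ### Working trees -/

namespace WorkingTree

open SimpleGraph

variable {ι : Type*} {S : SimpleGraph ι} {par : ι → Option ι} {N R R' a b : ι}

/-- The nodes of the subtree with root `N`. -/
def subtree (par : ι → Option ι) (N : ι) : Set ι := {a | Descends par a N}

theorem self_mem_subtree : N ∈ subtree par N := Relation.ReflTransGen.refl

theorem mem_subtree_iff : a ∈ subtree par N ↔ a = N ∨ ∃ R, par R = some N ∧ a ∈ subtree par R := by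
  constructor
  · intro h
    rcases Relation.ReflTransGen.cases_tail h with h | ⟨R, h1, h2⟩
    · exact .inl h.symm
    · exact .inr ⟨R, h2, h1⟩
  · rintro (rfl | ⟨R, h1, h2⟩)
    · exact self_mem_subtree
    · exact Relation.ReflTransGen.tail h2 h1

theorem rightUnique_par : Relator.RightUnique (fun x y => par x = some y) := by
  intro a b c h1 h2
  simpa using h1.symm.trans h2

/-- The subtree of every node is connected, and the subtrees of its children are the connected
components that remain when the node is removed. -/
structure IsCentered (S : SimpleGraph ι) (par : ι → Option ι) (N : ι) : Prop where
  joined : ∀ a ∈ subtree par N, ∀ b ∈ subtree par N, S.JoinedIn (subtree par N) a b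
  notMem : ∀ R, par R = some N → N ∉ subtree par R
  closed : ∀ R, par R = some N → ∀ a ∈ subtree par R, ∀ b,
    S.JoinedIn (subtree par N \ {N}) a b → b ∈ subtree par R

/-- The recursive definition, expressed through `par` alone. That every node but the root has its
parent inside `X` later identifies the root and locates nodes in components. -/
theorem IsWorkingTreeOn.exists_root {p : Option ι} {X : Set ι} (h : IsWorkingTreeOn S par p X) :
    ∃ c ∈ X, par c = p ∧
      ∀ a ∈ X, Descends par a c ∧ (a = c ∨ ∃ b ∈ X, par a = some b) := by
  induction h with
  | mk p X c hc hp h ih =>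
    refine ⟨c, hc, hp, fun a ha => ?_⟩
    by_cases hac : a = c
    · exact ⟨hac ▸ Relation.ReflTransGen.refl, .inl hac⟩
    · let a' : ↥(X \ {c}) := ⟨a, ha, hac⟩
      obtain ⟨r, hr, hrp, hr'⟩ := ih ((S.induce (X \ {c})).connectedComponentMk a')
      obtain ⟨h1, h2⟩ := hr' a ⟨a', rfl, rfl⟩
      refine ⟨h1.tail hrp, .inr ?_⟩
      rcases h2 with rfl | ⟨b, hb, h2⟩
      · exact ⟨c, hc, hrp⟩
      · obtain ⟨b', -, rfl⟩ := hb
        exact ⟨b', b'.2.1, h2⟩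

theorem subtree_eq_of_closed {X : Set ι} {c : ι} (hc : c ∈ X) (hX : ∀ a ∈ X, Descends par a c)
    (hcl : ∀ a b, par a = some b → b ∈ X → a ∈ X) : subtree par c = X := by
  refine Set.Subset.antisymm (fun a ha => ?_) hX
  refine Relation.ReflTransGen.head_induction_on ha hc ?_
  intro a b hab _ hb
  exact hcl a b hab hb

/-- Since `par` is a global function, the induction has to carry along that the parent of the root
is outside `X` and that `X` is closed under children. Then `X` is the whole subtree of its center,
and the same holds for each component left when the center is removed. -/
theorem IsWorkingTreeOn.isCentered {p : Option ι} {X : Set ι} (h : IsWorkingTreeOn S par p X)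
    (hp : ∀ b, p = some b → b ∉ X) (hcl : ∀ a b, par a = some b → b ∈ X → a ∈ X)
    (hX : ∀ a ∈ X, ∀ b ∈ X, S.JoinedIn X a b) : ∀ N ∈ X, IsCentered S par N := by
  induction h with
  | mk p X c hc hpc h ih =>
    -- `exists_root` yields some root; a root other than `c` would put the parent of `c` into `X`,
    -- against `hp`.
    have hdesc : ∀ a ∈ X, Descends par a c := by
      obtain ⟨c', hc', hpc', hX'⟩ := IsWorkingTreeOn.exists_root (.mk p X c hc hpc h)
      obtain rfl : c = c' := by
        rcases (hX' c hc).2 with h | ⟨b, hb, h⟩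
        · exact h
        · exact absurd hb (hp b (hpc.symm.trans h))
      exact fun a ha => (hX' a ha).1
    have hT : subtree par c = X := subtree_eq_of_closed hc hdesc hcl
    have hcK : ∀ K : (S.induce (X \ {c})).ConnectedComponent, c ∉ Subtype.val '' K.supp := by
      rintro K ⟨x, -, hx⟩
      exact x.2.2 hx
    have hKX : ∀ K : (S.induce (X \ {c})).ConnectedComponent, Subtype.val '' K.supp ⊆ X := by
      rintro K _ ⟨x, -, rfl⟩
      exact x.2.1
    -- The parent of `a` is `c` or lies in the same component as `a`; a parent in `K` therefore
    -- forces `a` into `K`.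
    have hKcl : ∀ K : (S.induce (X \ {c})).ConnectedComponent, ∀ a b, par a = some b →
        b ∈ Subtype.val '' K.supp → a ∈ Subtype.val '' K.supp := by
      intro K a b hab hb
      have haX := hcl a b hab (hKX K hb)
      have hac : a ≠ c := by
        rintro rfl
        exact hp b (hpc.symm.trans hab) (hKX K hb)
      obtain ⟨r, hr, hrp, hr'⟩ :=
        (h ((S.induce (X \ {c})).connectedComponentMk ⟨a, haX, hac⟩)).exists_root
      rcases (hr' a ⟨⟨a, haX, hac⟩, rfl, rfl⟩).2 with rfl | ⟨b', hb', hab'⟩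
      · obtain rfl : c = b := by simpa using hrp.symm.trans hab
        exact absurd hb (hcK K)
      · obtain rfl : b' = b := by simpa using hab'.symm.trans hab
        obtain ⟨x, hx, rfl⟩ := hb
        obtain ⟨y, hy, hxy⟩ := hb'
        obtain rfl : y = x := Subtype.ext hxy
        exact ⟨⟨a, haX, hac⟩, hy.symm.trans hx, rfl⟩
    have hchild : ∀ R, par R = some c → ∃ K : (S.induce (X \ {c})).ConnectedComponent,
        subtree par R = Subtype.val '' K.supp := by
      intro R hR
      have hRX := hcl R c hR hc
      have hRc : R ≠ c := by
        rintro rfl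
        exact hp R (hpc.symm.trans hR) hc
      refine ⟨(S.induce (X \ {c})).connectedComponentMk ⟨R, hRX, hRc⟩, ?_⟩
      obtain ⟨r, hr, hrp, hr'⟩ :=
        (h ((S.induce (X \ {c})).connectedComponentMk ⟨R, hRX, hRc⟩)).exists_root
      have hRmem : R ∈ Subtype.val ''
          ((S.induce (X \ {c})).connectedComponentMk ⟨R, hRX, hRc⟩).supp := ⟨_, rfl, rfl⟩
      obtain rfl : R = r := by
        rcases (hr' R hRmem).2 with h | ⟨b, hb, h⟩
        · exact h
        · obtain rfl : c = b := by simpa using hR.symm.trans h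
          exact absurd hb (hcK _)
      exact subtree_eq_of_closed hRmem (fun a ha => (hr' a ha).1) (hKcl _)
    intro N hN
    by_cases hNc : N = c
    · subst hNc
      refine ⟨?_, ?_, ?_⟩
      · rw [hT]
        exact hX
      · intro R hR
        obtain ⟨K, hK⟩ := hchild R hR
        rw [hK]
        exact hcK K
      · intro R hR a ha b hab
        obtain ⟨K, hK⟩ := hchild R hR
        rw [hT] at hab
        rw [hK] at ha ⊢
        exact K.mem_supp_of_joinedIn ha hab
    · refine ih ((S.induce (X \ {c})).connectedComponentMk ⟨N, hN, hNc⟩) ?_ (hKcl _) ?_ N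
        ⟨_, rfl, rfl⟩
      · rintro b hb
        obtain rfl : c = b := by simpa using hb
        exact hcK _
      · intro a ha b hb
        exact ConnectedComponent.joinedIn_supp _ ha hb

/-- As long as the chosen center is outside `Q`, all of `Q` stays in one of the remaining components
by `hQ'`, and the recursion continues there. The first center that belongs to `Q` has the whole
current node set below it. -/
theorem IsWorkingTreeOn.exists_top {p : Option ι} {X Q : Set ι} (h : IsWorkingTreeOn S par p X)
    (hS : S.IsAcyclic) (hX : ∀ a ∈ X, ∀ b ∈ X, S.JoinedIn X a b) (hQ : Q.Nonempty)
    (hQX : Q ⊆ X) (hQ' : ∀ c ∉ Q, ∀ a ∈ Q, ∀ b ∈ Q, S.JoinedIn {c}ᶜ a b) :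
    ∃ N ∈ Q, Q ⊆ subtree par N := by
  induction h with
  | mk p X c hc hpc h ih =>
    by_cases hcQ : c ∈ Q
    · obtain ⟨c', hc', hpc', hX'⟩ := IsWorkingTreeOn.exists_root (.mk p X c hc hpc h)
      by_cases hcc : c = c'
      · subst hcc
        exact ⟨c, hcQ, fun a ha => (hX' a (hQX ha)).1⟩
      · refine ⟨c, hcQ, fun a ha => ?_⟩
        by_cases hac : a = c
        · exact hac ▸ self_mem_subtree
        · obtain ⟨r, hr, hrp, hr'⟩ :=
            (h ((S.induce (X \ {c})).connectedComponentMk ⟨a, hQX ha, hac⟩)).exists_root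
          exact (hr' a ⟨_, rfl, rfl⟩).1.tail hrp
    · obtain ⟨q, hq⟩ := hQ
      have hqc : q ≠ c := fun h => hcQ (h ▸ hq)
      refine ih ((S.induce (X \ {c})).connectedComponentMk ⟨q, hQX hq, hqc⟩)
        (fun a ha b hb => ConnectedComponent.joinedIn_supp _ ha hb) fun a ha => ?_
      exact ConnectedComponent.mem_supp_of_joinedIn _ ⟨_, rfl, rfl⟩
        ((hX q (hQX hq) a (hQX ha)).diff_singleton hS (hQ' c hcQ q hq a ha))

theorem joinedIn_univ (hS : S.IsTree) (a b : ι) : S.JoinedIn Set.univ a b := by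
  obtain ⟨p⟩ := hS.connected.preconnected a b
  exact ⟨p, by simp⟩

theorem IsWorkingTree.isCentered (hpar : IsWorkingTree S par) (hS : S.IsTree) (N : ι) : IsCentered S par N :=
  IsWorkingTreeOn.isCentered hpar (by simp) (by simp) (fun a _ b _ => joinedIn_univ hS a b) N
    trivial

theorem IsWorkingTree.exists_top (hpar : IsWorkingTree S par) (hS : S.IsTree) {Q : Set ι}
    (hQ : Q.Nonempty)
    (hQ' : ∀ c ∉ Q, ∀ a ∈ Q, ∀ b ∈ Q, S.JoinedIn {c}ᶜ a b) : ∃ N ∈ Q, Q ⊆ subtree par N :=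
  IsWorkingTreeOn.exists_top hpar hS.isAcyclic (fun a _ b _ => joinedIn_univ hS a b) hQ
    (Set.subset_univ Q) hQ'

/-- The ancestors of a node form a chain, so a common descendant would make one sibling a descendant
of the other; then `N` would lie below its own child. -/
theorem disjoint_subtree (hc : ∀ N, IsCentered S par N) (hR : par R = some N)
    (hR' : par R' = some N) (hne : R ≠ R') : Disjoint (subtree par R) (subtree par R') := by
  have key : ∀ R R', par R = some N → par R' = some N → R ≠ R' → ¬ Descends par R R' := by
    intro R R' hR hR' hne h
    rcases Relation.ReflTransGen.cases_head h with h | ⟨c, h1, h2⟩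
    · exact hne h
    · obtain rfl : N = c := by simpa using hR.symm.trans h1
      exact (hc N).notMem R' hR' h2
  rw [Set.disjoint_left]
  intro a ha ha'
  rcases Relation.ReflTransGen.total_of_right_unique rightUnique_par ha ha' with h | h
  · exact key R R' hR hR' hne h
  · exact key R' R hR' hR hne.symm h

theorem level_child [Finite ι] (hc : ∀ N, IsCentered S par N) (hR : par R = some N) :
    level par R = level par N + 1 := by
  have : {a | Descends par R a} = insert R {a | Descends par N a} := by
    ext a
    simp only [Set.mem_ofPred_eq, Set.mem_insert_iff]
    constructor
    · intro h
      rcases Relation.ReflTransGen.cases_head h with h | ⟨c, h1, h2⟩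
      · exact .inl h.symm
      · obtain rfl : N = c := by simpa using hR.symm.trans h1
        exact .inr h2
    · rintro (rfl | h)
      · exact Relation.ReflTransGen.refl
      · exact h.head hR
  have hR' : R ∉ {a | Descends par N a} := fun h => (hc N).notMem R hR h
  rw [level, this, Set.ncard_insert_of_notMem hR']
  rfl

theorem level_le [Fintype ι] (N : ι) : level par N ≤ Finset.univ.sup (level par) :=
  Finset.le_sup (f := level par) (Finset.mem_univ N)

theorem height_pos [Fintype ι] (N : ι) : 0 < height par N := by
  have := level_le (par := par) N
  unfold height
  omega

theorem height_child [Fintype ι] (hc : ∀ N, IsCentered S par N) (hR : par R = some N) :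
    height par N = height par R + 1 := by
  have h1 := level_le (par := par) R
  have h2 := level_child hc hR
  unfold height
  omega

theorem induction_on_children [Fintype ι] (hc : ∀ N, IsCentered S par N) {P : ι → Prop}
    (h : ∀ N, (∀ R, par R = some N → P R) → P N) (N : ι) : P N := by
  induction hn : height par N using Nat.strong_induction_on generalizing N with
  | _ n ih =>
    refine h N fun R hR => ih (height par R) ?_ R rfl
    have := height_child hc hR
    omega

open Classical in
-- The leaf sets of the children are disjoint subsets of the leaf set of `N`.
theorem sum_leaves_le [Fintype ι] (hc : ∀ N, IsCentered S par N) (N : ι) :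
    ∑ R with par R = some N, leaves par R ≤ leaves par N := by
  have h1 : ∀ R, leaves par R =
      (Finset.univ.filter fun a => Descends par a R ∧ ∀ x, par x ≠ some a).card := by
    intro R
    rw [leaves, Set.ncard_eq_toFinset_card']
    congr 1
    ext
    simp
  simp_rw [h1]
  rw [← Finset.card_biUnion]
  · refine Finset.card_le_card fun a ha => ?_
    simp only [Finset.mem_biUnion, Finset.mem_filter, Finset.mem_univ, true_and] at ha ⊢
    obtain ⟨R, hR, ha, hl⟩ := ha
    exact ⟨ha.tail hR, hl⟩
  · intro R hR R' hR' hne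
    simp only [Finset.coe_filter, Finset.mem_univ, true_and, Set.mem_ofPred_eq] at hR hR'
    rw [Function.onFun, Finset.disjoint_left]
    intro a ha ha'
    exact Set.disjoint_left.1 (disjoint_subtree hc hR hR' hne) (Finset.mem_filter.1 ha).2.1
      (Finset.mem_filter.1 ha').2.1

theorem leaves_pos [Fintype ι] (hc : ∀ N, IsCentered S par N) (N : ι) : 0 < leaves par N := by
  classical
  induction N using induction_on_children hc with
  | h N ih =>
    by_cases hN : ∃ R, par R = some N
    · obtain ⟨R, hR⟩ := hN
      refine (ih R hR).trans_le (le_trans ?_ (sum_leaves_le hc N))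
      exact Finset.single_le_sum (f := leaves par) (fun _ _ => Nat.zero_le _) (by simpa using hR)
    · rw [leaves, Set.ncard_pos (Set.toFinite _)]
      exact ⟨N, Relation.ReflTransGen.refl, fun x hx => hN ⟨x, hx⟩⟩

/-- The subtree of a child of `N` contains a neighbour of `N`. -/
theorem exists_adj_mem_subtree (hc : ∀ N, IsCentered S par N) (hR : par R = some N) :
    ∃ M, S.Adj N M ∧ Descends par M R := by
  obtain ⟨x, y, hxy, hx, hy, hxR, hyR⟩ := ((hc N).joined R
    (mem_subtree_iff.2 (.inr ⟨R, hR, self_mem_subtree⟩)) N self_mem_subtree).exists_exit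
      (Y := subtree par R) self_mem_subtree ((hc N).notMem R hR)
  have hxN : x ≠ N := fun h => (hc N).notMem R hR (h ▸ hxR)
  obtain rfl : y = N := by
    by_contra hyN
    exact hyR ((hc N).closed R hR x hxR y (.of_adj hxy ⟨hx, hxN⟩ ⟨hy, hyN⟩))
  exact ⟨x, hxy.symm, hxR⟩

theorem joinedIn_of_mem_subtree (hc : ∀ N, IsCentered S par N) (hR : par R = some N)
    (ha : Descends par a R) (hb : Descends par b R) : S.JoinedIn {N}ᶜ a b := by
  refine ((hc R).joined a ha b hb).mono fun x hx hxN => ?_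
  obtain rfl : x = N := hxN
  exact (hc x).notMem R hR hx

end WorkingTree

/-! ### The directed edges of a cycle -/

open SimpleGraph

/-- `Q` is the set of directed edges of a cycle. -/
structure IsCycleDarts {V : Type*} {G : SimpleGraph V} (Q : Finset G.Dart) : Prop where
  fst_inj : ∀ d ∈ Q, ∀ d' ∈ Q, d.fst = d'.fst → d = d'
  snd_inj : ∀ d ∈ Q, ∀ d' ∈ Q, d.snd = d'.snd → d = d'
  symm_notMem : ∀ d ∈ Q, d.symm ∉ Q
  exists_fst_iff : ∀ v, (∃ d ∈ Q, d.fst = v) ↔ ∃ d ∈ Q, d.snd = v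
  /-- a property that passes to the next edge, in both directions, holds everywhere or nowhere -/
  connected : ∀ P : G.Dart → Prop, (∀ d ∈ Q, ∀ d' ∈ Q, d.snd = d'.fst → (P d ↔ P d')) →
    ∀ d ∈ Q, ∀ d' ∈ Q, P d → P d'

namespace SimpleGraph.Walk

variable {V : Type*} {G : SimpleGraph V} {u : V} {C : G.Walk u u}

theorem IsCycle.nodup_darts (hC : C.IsCycle) : C.darts.Nodup :=
  List.Nodup.of_map (fun d : G.Dart => d.snd) (by
    rw [map_snd_darts]
    exact hC.support_nodup)

open Classical in
theorem IsCycle.isCycleDarts (hC : C.IsCycle) : IsCycleDarts C.darts.toFinset where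
  fst_inj d hd d' hd' h := by
    have := hC.nodup_dropLast_support
    rw [← map_fst_darts] at this
    exact List.inj_on_of_nodup_map this (List.mem_toFinset.1 hd) (List.mem_toFinset.1 hd') h
  snd_inj d hd d' hd' h := by
    have := hC.support_nodup
    rw [← map_snd_darts] at this
    exact List.inj_on_of_nodup_map this (List.mem_toFinset.1 hd) (List.mem_toFinset.1 hd') h
  symm_notMem d hd hd' := by
    have : (C.darts.map Dart.edge).Nodup := hC.edges_nodup
    exact d.symm_ne (List.inj_on_of_nodup_map this (List.mem_toFinset.1 hd')
      (List.mem_toFinset.1 hd) d.edge_symm)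
  exists_fst_iff v := by
    have h1 : (∃ d ∈ C.darts.toFinset, d.fst = v) ↔ v ∈ C.darts.map (fun d => d.fst) := by
      simp only [List.mem_toFinset, List.mem_map]
    have h2 : (∃ d ∈ C.darts.toFinset, d.snd = v) ↔ v ∈ C.darts.map (fun d => d.snd) := by
      simp only [List.mem_toFinset, List.mem_map]
    rw [h1, h2, map_fst_darts, map_snd_darts]
    exact C.tail_support_perm_dropLast_support.mem_iff.symm
  connected P hP d hd d' hd' hPd := by
    have h1 : C.darts.IsChain fun d d' => P d ↔ P d' := by
      refine List.IsChain.imp_of_mem_imp (fun a b ha hb hab => ?_) C.isChain_dartAdj_darts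
      exact hP a (List.mem_toFinset.2 ha) b (List.mem_toFinset.2 hb) hab
    have : IsTrans G.Dart fun d d' => (P d ↔ P d') := ⟨fun _ _ _ h h' => h.trans h'⟩
    have : Std.Symm fun d d' : G.Dart => (P d ↔ P d') := ⟨fun _ _ h => h.symm⟩
    have h2 : C.darts.Pairwise fun d d' => P d ↔ P d' := List.isChain_iff_pairwise.1 h1
    have h3 := List.Pairwise.forall_of_forall (R := fun d d' : G.Dart => (P d ↔ P d'))
      (fun _ _ => Iff.rfl) h2
      (List.mem_toFinset.1 hd) (List.mem_toFinset.1 hd')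
    exact h3.1 hPd

open Classical in
theorem IsCycle.circulation_eq (hC : C.IsCycle) (w : G.Dart → ℤ) :
    ComponentTree.circulation w C = ∑ d ∈ C.darts.toFinset, w d :=
  (List.sum_toFinset w hC.nodup_darts).symm

end SimpleGraph.Walk

namespace ComponentTree

variable {V ι : Type*} {G : SimpleGraph V} (D : ComponentTree G ι)

theorem exists_mem_of_projection_ne_nil {u : V} {C : G.Walk u u} {N : ι}
    (h : D.projection C N ≠ []) : ∃ d ∈ C.darts, D.dartHome d = N := by
  classical
  have hf : D.fragment C N ≠ [] := by
    intro h'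
    apply h
    simp [projection, h']
  obtain ⟨d, hd⟩ := List.exists_mem_of_ne_nil _ hf
  simp only [fragment, List.mem_filter, decide_eq_true_eq] at hd
  exact ⟨d, hd⟩

theorem fst_mem_bag (d : G.Dart) : d.fst ∈ D.bag (D.dartHome d) :=
  D.home_mem ⟨d.edge, d.edge_mem⟩ d.fst (by simp [Dart.edge])

theorem snd_mem_bag (d : G.Dart) : d.snd ∈ D.bag (D.dartHome d) :=
  D.home_mem ⟨d.edge, d.edge_mem⟩ d.snd (by simp [Dart.edge])

/-! ### Sides of a component -/

/-- The components on the side of `N` that contains its neighbour `M`. -/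
def side (N M : ι) : Set ι := {P | D.tree.JoinedIn {N}ᶜ M P}

variable {D} {N M M' P P' : ι} {v : V}

theorem ne_of_mem_side (h : P ∈ D.side N M) : P ≠ N := h.right_mem

theorem mem_side_self (h : D.tree.Adj N M) : M ∈ D.side N M := .refl h.ne'

theorem exists_mem_side (h : P ≠ N) : ∃ M, D.tree.Adj N M ∧ P ∈ D.side N M :=
  D.isTree.connected.exists_adj_joinedIn h

theorem side_unique (hM : D.tree.Adj N M) (hM' : D.tree.Adj N M') (h : P ∈ D.side N M)
    (h' : P ∈ D.side N M') : M = M' :=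
  JoinedIn.eq_of_adj D.isTree.isAcyclic hM hM' (h.trans h'.symm)

theorem joinedIn_bag (h : v ∈ D.bag P) (h' : v ∈ D.bag P') :
    D.tree.JoinedIn {Q | v ∈ D.bag Q} P P' :=
  .of_reachable (D.bag_connected v ⟨P, h⟩ ⟨P', h'⟩)

/-- A component on one side of `N` meets `N` only in the corresponding separating set. -/
theorem mem_sep_of_mem_side (hM : D.tree.Adj N M) (hP : P ∈ D.side N M) (hv : v ∈ D.bag P)
    (hvN : v ∈ D.bag N) : v ∈ D.sep N M := by
  obtain ⟨x, y, hxy, hx, hy, hxs, hys⟩ :=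
    (joinedIn_bag hv hvN).exists_exit (Y := D.side N M) hP (fun h => ne_of_mem_side h rfl)
  obtain rfl : y = N := by
    by_contra hyN
    exact hys (hxs.trans (.of_adj hxy (ne_of_mem_side hxs) hyN))
  obtain rfl : M = x := side_unique hM hxy.symm hxs (mem_side_self hxy.symm)
  exact ⟨hvN, hx⟩

/-- The components that contain `v` are connected in the tree, and `N` is not one of them. -/
theorem mem_side_iff_of_notMem (hP : v ∈ D.bag P) (hP' : v ∈ D.bag P') (hv : v ∉ D.bag N) :
    P ∈ D.side N M ↔ P' ∈ D.side N M := by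
  have h : D.tree.JoinedIn {N}ᶜ P P' := (joinedIn_bag hP hP').mono fun Q hQ hQN => by
    obtain rfl : Q = N := hQN
    exact hv hQ
  exact ⟨fun h' => h'.trans h, fun h' => h'.trans h.symm⟩

theorem eq_of_mem_sep (hM : D.tree.Adj N M) (hM' : D.tree.Adj N M') (hv : v ∈ D.sep N M)
    (hv' : v ∈ D.sep N M') : M = M' := by
  by_contra h
  exact Set.disjoint_left.1 (D.sep_disjoint N M M' hM hM' h) hv hv'

/-- Components that share a vertex and are different from `N` lie on the same side of `N`. -/
theorem joinedIn_of_mem_bag (hP : v ∈ D.bag P) (hP' : v ∈ D.bag P') (hPN : P ≠ N)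
    (hPN' : P' ≠ N) : D.tree.JoinedIn {N}ᶜ P P' := by
  obtain ⟨M, hM, h⟩ := exists_mem_side hPN
  obtain ⟨M', hM', h'⟩ := exists_mem_side hPN'
  by_cases hv : v ∈ D.bag N
  · obtain rfl : M = M' := eq_of_mem_sep hM hM' (mem_sep_of_mem_side hM h hP hv)
      (mem_sep_of_mem_side hM' h' hP' hv)
    exact h.symm.trans h'
  · exact h.symm.trans ((mem_side_iff_of_notMem hP hP' hv).1 h)

/-- The components met by a cycle lie on one side of every other component. -/
theorem joinedIn_of_isCycleDarts {Q : Finset G.Dart} (hQ : IsCycleDarts Q)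
    (hN : ∀ d ∈ Q, D.dartHome d ≠ N) {d d' : G.Dart} (hd : d ∈ Q) (hd' : d' ∈ Q) :
    D.tree.JoinedIn {N}ᶜ (D.dartHome d) (D.dartHome d') := by
  refine hQ.connected (fun e => D.tree.JoinedIn {N}ᶜ (D.dartHome d) (D.dartHome e)) ?_ d hd d' hd'
    (.refl (hN d hd))
  intro a ha b hb hab
  have h := joinedIn_of_mem_bag (hab ▸ D.snd_mem_bag a) (D.fst_mem_bag b) (hN a ha) (hN b hb)
  exact ⟨fun h' => h'.trans h, fun h' => h'.trans h.symm⟩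

/-! ### Crossings of a cycle -/

open Classical in
/-- The number of times (`1`, `0` or `-1`) that the cycle `Q` enters the set `W` of components at
the vertex `v`. -/
noncomputable def entry (D : ComponentTree G ι) (Q : Finset G.Dart) (W : Set ι) (v : V) : ℤ :=
  ∑ d ∈ Q, if D.dartHome d ∈ W then
    (if d.fst = v then 1 else 0) - (if d.snd = v then 1 else 0) else 0

variable {Q : Finset G.Dart} {d d' : G.Dart} {W : Set ι}

open Classical in
theorem sum_ite_eq_of_injOn {α β : Type*} {Q : Finset α} {g : α → β} {d : α}
    (h : ∀ d ∈ Q, ∀ d' ∈ Q, g d = g d' → d = d') (hd : d ∈ Q) (f : α → ℤ) :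
    (∑ e ∈ Q, if g e = g d then f e else 0) = f d := by
  rw [Finset.sum_eq_single d]
  · simp
  · intro e he hne
    rw [if_neg fun h' => hne (h e he d hd h')]
  · exact fun h => absurd hd h

open Classical in
-- No other edges of the cycle meet this vertex, so the sum reduces to the edge that arrives and the
-- edge that leaves.
theorem entry_eq (hQ : IsCycleDarts Q) (hd : d ∈ Q) (hd' : d' ∈ Q) (h : d.snd = d'.fst) :
    D.entry Q W d'.fst = (if D.dartHome d' ∈ W then 1 else 0) -
      (if D.dartHome d ∈ W then 1 else 0) := by
  have h1 := sum_ite_eq_of_injOn (g := fun e : G.Dart => e.fst) hQ.fst_inj hd'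
    (fun e => if D.dartHome e ∈ W then 1 else 0)
  have h2 := sum_ite_eq_of_injOn (g := fun e : G.Dart => e.snd) hQ.snd_inj hd
    (fun e => if D.dartHome e ∈ W then 1 else 0)
  rw [entry, ← h1, ← h2, ← Finset.sum_sub_distrib]
  refine Finset.sum_congr rfl fun e _ => ?_
  rw [h]
  split_ifs <;> simp

theorem entry_eq_zero_of_notMem (hQ : IsCycleDarts Q) (h : ∀ d ∈ Q, d.fst ≠ v) :
    D.entry Q W v = 0 := by
  have h' : ∀ d ∈ Q, d.snd ≠ v := by
    intro d hd hdv
    obtain ⟨e, he, hev⟩ := (hQ.exists_fst_iff v).2 ⟨d, hd, hdv⟩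
    exact h e he hev
  refine Finset.sum_eq_zero fun d hd => ?_
  simp [h d hd, h' d hd]

/-- A vertex is not on the cycle, or it is where one edge ends and the next one starts. -/
theorem _root_.IsCycleDarts.vertex_cases (hQ : IsCycleDarts Q) (v : V) :
    (∀ d ∈ Q, d.fst ≠ v) ∨ ∃ d ∈ Q, ∃ d' ∈ Q, d.snd = d'.fst ∧ v = d'.fst := by
  by_cases h : ∃ d ∈ Q, d.fst = v
  · obtain ⟨d', hd', rfl⟩ := h
    obtain ⟨d, hd, h⟩ := (hQ.exists_fst_iff d'.fst).1 ⟨d', hd', rfl⟩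
    exact .inr ⟨d, hd, d', hd', h, rfl⟩
  · push Not at h
    exact .inl h

theorem entry_values (hQ : IsCycleDarts Q) (W : Set ι) (v : V) :
    D.entry Q W v = 0 ∨ D.entry Q W v = 1 ∨ D.entry Q W v = -1 := by
  rcases hQ.vertex_cases v with h | ⟨d, hd, d', hd', h, rfl⟩
  · exact .inl (entry_eq_zero_of_notMem hQ h)
  · rw [entry_eq hQ hd hd' h]
    split_ifs <;> simp

/-- At a vertex outside `N`, all components containing it are on the same side, so nothing is
crossed. At a vertex of `N`, one of the two edges lies on the side of `M`, and that side meets `N`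
only in the separating set. -/
theorem mem_sep_of_entry_ne_zero (hQ : IsCycleDarts Q) (hM : D.tree.Adj N M)
    (hv : D.entry Q (D.side N M) v ≠ 0) : v ∈ D.sep N M := by
  rcases hQ.vertex_cases v with h | ⟨d, hd, d', hd', h, rfl⟩
  · exact absurd (entry_eq_zero_of_notMem hQ h) hv
  · have h1 := D.snd_mem_bag d
    rw [h] at h1
    have h2 := D.fst_mem_bag d'
    rw [entry_eq hQ hd hd' h] at hv
    by_cases hN : d'.fst ∈ D.bag N
    · by_cases hs : D.dartHome d ∈ D.side N M
      · exact mem_sep_of_mem_side hM hs h1 hN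
      · by_cases hs' : D.dartHome d' ∈ D.side N M
        · exact mem_sep_of_mem_side hM hs' h2 hN
        · simp [hs, hs'] at hv
    · have hiff := mem_side_iff_of_notMem (M := M) h1 h2 hN
      by_cases hs : D.dartHome d ∈ D.side N M
      · simp [hs, hiff.1 hs] at hv
      · simp [hs, mt hiff.2 hs] at hv

theorem sum_entry [Fintype V] (Q : Finset G.Dart) (W : Set ι) : ∑ v, D.entry Q W v = 0 := by
  classical
  unfold entry
  rw [Finset.sum_comm]
  refine Finset.sum_eq_zero fun d _ => ?_
  split_ifs
  · simp [Finset.sum_sub_distrib]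
  · simp

/-- Every component is `N` or lies on exactly one side of `N`. -/
theorem sum_side [Fintype ι] (N P : ι) (c : ι → ℤ) [DecidableRel D.tree.Adj]
    [∀ M, Decidable (P ∈ D.side N M)] :
    (P = N ∧ (∑ M with D.tree.Adj N M, if P ∈ D.side N M then c M else 0) = 0) ∨
    (P ≠ N ∧ ∃ M, D.tree.Adj N M ∧ P ∈ D.side N M ∧
      (∑ M with D.tree.Adj N M, if P ∈ D.side N M then c M else 0) = c M) := by
  by_cases h : P = N
  · refine .inl ⟨h, Finset.sum_eq_zero fun M _ => ?_⟩
    rw [if_neg fun h' => ne_of_mem_side h' h]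
  · obtain ⟨M, hM, hP⟩ := exists_mem_side h
    refine .inr ⟨h, M, hM, hP, ?_⟩
    rw [Finset.sum_eq_single_of_mem M (by simpa using hM), if_pos hP]
    intro M' hM' hne
    rw [if_neg fun h' => hne (side_unique (by simpa using hM') hM h' hP)]

/-- If a cycle meets both a side of `N` and its complement, it enters that side somewhere. -/
theorem exists_entry_ne_zero (hQ : IsCycleDarts Q) (hd : d ∈ Q) (hd' : d' ∈ Q)
    (h : D.dartHome d ∈ W) (h' : D.dartHome d' ∉ W) : ∃ v, D.entry Q W v ≠ 0 := by
  by_contra! hv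
  refine h' (hQ.connected (fun e => D.dartHome e ∈ W) ?_ d hd d' hd' h)
  intro a ha b hb hab
  have := hv b.fst
  rw [entry_eq hQ ha hb hab] at this
  by_cases h1 : D.dartHome a ∈ W <;> by_cases h2 : D.dartHome b ∈ W <;> simp_all

/-- Integers `0`, `1`, `-1` with sum zero, at most three of them nonzero: the value `1` is taken at
most once. -/
theorem eq_of_eq_one {α : Type*} [Fintype α] {s : Finset α} (hs : s.card ≤ 3) {b : α → ℤ}
    (hb : ∀ x, b x = 0 ∨ b x = 1 ∨ b x = -1) (hbs : ∀ x, b x ≠ 0 → x ∈ s) (h0 : ∑ x, b x = 0)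
    {x y : α} (hx : b x = 1) (hy : b y = 1) : x = y := by
  classical
  by_contra hxy
  have h1 : ∑ x ∈ s, b x = 0 := by
    rw [← h0]
    exact Finset.sum_subset (Finset.subset_univ s) fun z _ hz => by
      by_contra h
      exact hz (hbs z h)
  have hxs : x ∈ s := hbs x (by simp [hx])
  have hys : y ∈ s.erase x := Finset.mem_erase.2 ⟨Ne.symm hxy, hbs y (by simp [hy])⟩
  rw [← Finset.add_sum_erase s b hxs, ← Finset.add_sum_erase _ b hys, hx, hy] at h1
  -- Two values `1` add up to `2`, and the at most one remaining term is at least `-1`, so the total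
  -- could not be zero.
  have hcard : ((s.erase x).erase y).card ≤ 1 := by
    rw [Finset.card_erase_of_mem hys, Finset.card_erase_of_mem hxs]
    omega
  have h2 : -1 ≤ ∑ z ∈ (s.erase x).erase y, b z := by
    have := Finset.card_nsmul_le_sum ((s.erase x).erase y) b (-1) (fun z _ => by
      rcases hb z with h | h | h <;> omega)
    simp only [nsmul_eq_mul] at this
    have h3 : (((s.erase x).erase y).card : ℤ) ≤ 1 := by exact_mod_cast hcard
    linarith
  linarith

open Classical in
theorem card_sep_le [Finite V] (hM : D.tree.Adj N M) :
    (Set.toFinite (D.sep N M)).toFinset.card ≤ 3 := by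
  rw [← Set.ncard_eq_toFinset_card]
  rcases D.sep_card N M hM with h | h <;> simp only [sep] <;> omega

theorem eq_of_entry_eq_one [Fintype V] (hQ : IsCycleDarts Q) (hM : D.tree.Adj N M) {x y : V}
    (hx : D.entry Q (D.side N M) x = 1) (hy : D.entry Q (D.side N M) y = 1) : x = y :=
  eq_of_eq_one (card_sep_le hM) (entry_values hQ _)
    (fun x hx => by simpa using mem_sep_of_entry_ne_zero hQ hM hx) (sum_entry Q _) hx hy

theorem eq_of_entry_eq_neg_one [Fintype V] (hQ : IsCycleDarts Q) (hM : D.tree.Adj N M) {x y : V}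
    (hx : D.entry Q (D.side N M) x = -1) (hy : D.entry Q (D.side N M) y = -1) : x = y := by
  refine eq_of_eq_one (b := fun v => - D.entry Q (D.side N M) v) (card_sep_le hM) (fun x => ?_)
    (fun x hx => ?_) ?_ (by simp [hx]) (by simp [hy])
  · rcases entry_values (D := D) hQ (D.side N M) x with h | h | h <;> simp [h]
  · simpa using mem_sep_of_entry_ne_zero hQ hM (neg_ne_zero.1 hx)
  · simp [sum_entry]

end ComponentTree

/-! ### Rotation systems -/

namespace RotationSystem

variable {X U F : Type*}
  {rev : X → X} {rot : Equiv.Perm X} {tail : X → U} {face : X → F}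

open Classical in
/-- A coboundary has no divergence. -/
theorem sum_coboundary [Fintype X] {R : Type*} [AddCommGroup R] (hrev : Function.Involutive rev)
    (htail : ∀ d, tail (rot d) = tail d) (hface : ∀ d, face (rot (rev d)) = face d)
    (φ : F → R) (v : U) :
    (∑ d, if tail d = v then φ (face d) - φ (face (rev d)) else 0) = 0 := by
  have h : (∑ d, if tail d = v then φ (face d) else 0) =
      ∑ d, if tail d = v then φ (face (rev d)) else 0 := by
    rw [← Equiv.sum_comp rot]
    refine Finset.sum_congr rfl fun d _ => ?_
    rw [htail, ← hface (rev d), hrev d]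
  rw [← sub_eq_zero] at h
  refine Eq.trans ?_ h
  rw [← Finset.sum_sub_distrib]
  refine Finset.sum_congr rfl fun d _ => ?_
  split_ifs <;> simp

variable (rev)

/-- Functions on directed edges that do not depend on the direction. -/
def symmetricFunctions : Submodule (ZMod 2) (X → ZMod 2) where
  carrier := {z | ∀ d, z (rev d) = z d}
  add_mem' := fun {a b} ha hb d => by simp [ha d, hb d]
  zero_mem' := fun _ => rfl
  smul_mem' := fun c a ha d => by simp [ha d]

variable {rev}

/-- `O` selects one direction of every edge: it is half of `X`, and a symmetric function is
determined by its values on it. -/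
theorem two_mul_finrank_symmetricFunctions_le [Fintype X] (hrev : Function.Involutive rev) {O : Set X}
    (hO : ∀ d, rev d ∈ O ↔ d ∉ O) :
    2 * Module.finrank (ZMod 2) (symmetricFunctions rev) ≤ Fintype.card X := by
  classical
  let r : symmetricFunctions rev →ₗ[ZMod 2] (O → ZMod 2) :=
    (LinearMap.funLeft (ZMod 2) (ZMod 2) (Subtype.val : O → X)).comp
      (symmetricFunctions rev).subtype
  have hr : Function.Injective r := by
    intro z z' h
    ext d
    by_cases hd : d ∈ O
    · exact congrFun h ⟨d, hd⟩
    · rw [← z.2 d, ← z'.2 d]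
      exact congrFun h ⟨rev d, (hO d).2 hd⟩
  have h1 := LinearMap.finrank_le_finrank_of_injective hr
  rw [Module.finrank_fintype_fun_eq_card] at h1
  have h2 : Fintype.card O = Fintype.card (Oᶜ : Set X) := by
    refine Fintype.card_congr
      ⟨fun d => ⟨rev d, fun h => (hO d).1 h d.2⟩, fun d => ⟨rev d, (hO d).2 d.2⟩, ?_, ?_⟩
    · intro d
      exact Subtype.ext (hrev d)
    · intro d
      exact Subtype.ext (hrev d)
  have h3 := Fintype.card_compl_set O
  have h4 := Fintype.card_subtype_le (fun x => x ∈ O)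
  have h5 : Fintype.card O ≤ Fintype.card X := h4
  omega

variable [Fintype X] [DecidableEq U]

variable (tail) in
/-- The sum over the edges at each vertex. -/
def boundary : (X → ZMod 2) →ₗ[ZMod 2] (U → ZMod 2) where
  toFun z v := ∑ d, if tail d = v then z d else 0
  map_add' z z' := by
    ext v
    simp only [Pi.add_apply, ← Finset.sum_add_distrib]
    refine Finset.sum_congr rfl fun d _ => ?_
    split_ifs <;> simp
  map_smul' c z := by
    ext v
    simp [Finset.mul_sum]

theorem boundary_single [DecidableEq X] (d : X) :
    boundary tail (Pi.single d 1) = Pi.single (tail d) 1 := by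
  ext v
  change (∑ e, if tail e = v then (Pi.single d 1 : X → ZMod 2) e else 0) = _
  rw [Finset.sum_eq_single d]
  · simp [Pi.single_apply, eq_comm]
  · intro e _ he
    simp [he]
  · simp

/-- Walking from `r` along edges, the indicator of every vertex agrees with that of `r` modulo
boundaries. The boundaries thus have codimension at most one. -/
theorem card_le_finrank_range_boundary_add_one [Fintype U] (hrev : Function.Involutive rev) [Nonempty U]
    (hconn : ∀ u v, Relation.ReflTransGen (fun a b => ∃ d, tail d = a ∧ tail (rev d) = b) u v) :
    Fintype.card U ≤ Module.finrank (ZMod 2)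
      ((boundary tail).domRestrict (symmetricFunctions rev)).range + 1 := by
  classical
  obtain ⟨r⟩ := ‹Nonempty U›
  set W := ((boundary tail).domRestrict (symmetricFunctions rev)).range
  set L : Submodule (ZMod 2) (U → ZMod 2) := Submodule.span (ZMod 2) {Pi.single r 1}
  have hmem : ∀ u, (Pi.single u 1 : U → ZMod 2) ∈ W ⊔ L := by
    intro u
    induction hconn r u with
    | refl => exact Submodule.mem_sup_right (Submodule.mem_span_singleton_self _)
    | @tail b c _ hbc ih =>
      obtain ⟨d, rfl, rfl⟩ := hbc
      have hz : (Pi.single d 1 + Pi.single (rev d) 1 : X → ZMod 2) ∈ symmetricFunctions rev := by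
        intro e
        have h1 : rev e = d ↔ e = rev d := ⟨fun h => by rw [← h, hrev e], fun h => by rw [h, hrev d]⟩
        simp only [Pi.add_apply, Pi.single_apply, h1, hrev.injective.eq_iff]
        exact add_comm _ _
      have hW : (Pi.single (tail d) 1 + Pi.single (tail (rev d)) 1 : U → ZMod 2) ∈ W :=
        ⟨⟨_, hz⟩, by simp [LinearMap.domRestrict_apply, boundary_single]⟩
      have := Submodule.sub_mem _ (Submodule.mem_sup_left (T := L) hW) ih
      simpa using this
  have htop : W ⊔ L = ⊤ := by
    rw [eq_top_iff]
    intro x _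
    rw [pi_eq_sum_univ' x]
    refine Submodule.sum_mem _ fun u _ => Submodule.smul_mem _ _ ?_
    exact hmem u
  have h1 := Submodule.finrank_add_le_finrank_add_finrank W L
  rw [htop, finrank_top, Module.finrank_fintype_fun_eq_card] at h1
  have h2 : Module.finrank (ZMod 2) L ≤ 1 := by
    simpa using finrank_span_le_card (R := ZMod 2) ({Pi.single r 1} : Set (U → ZMod 2))
  omega

variable (rev face) in
/-- The coboundary of a function on the faces. -/
def coboundary (hrev : Function.Involutive rev) :
    (F → ZMod 2) →ₗ[ZMod 2] symmetricFunctions rev where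
  toFun φ := ⟨fun d => φ (face d) + φ (face (rev d)), fun d => by
    change φ (face (rev d)) + φ (face (rev (rev d))) = _
    rw [hrev d, add_comm]⟩
  map_add' φ ψ := by
    ext d
    simp only [Pi.add_apply, Submodule.coe_add]
    ring
  map_smul' c φ := by
    ext d
    simp [mul_add]

/-- In a rotation system of genus zero, every even set of edges is the boundary of a set of
faces. -/
theorem exists_coboundary_eq [Fintype U] [Fintype F] (hrev : Function.Involutive rev) {O : Set X}
    (hO : ∀ d, rev d ∈ O ↔ d ∉ O) [Nonempty U]
    (htail : ∀ d, tail (rot d) = tail d) (hface : ∀ d, face (rot (rev d)) = face d)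
    (hconn : ∀ u v, Relation.ReflTransGen (fun a b => ∃ d, tail d = a ∧ tail (rev d) = b) u v)
    (hfaces : ∀ φ : F → ZMod 2, (∀ d, φ (face d) = φ (face (rev d))) → ∀ f g, φ f = φ g)
    (heuler : Fintype.card X + 4 ≤ 2 * Fintype.card U + 2 * Fintype.card F)
    {z : X → ZMod 2} (hz : ∀ d, z (rev d) = z d)
    (hz' : ∀ v, (∑ d, if tail d = v then z d else 0) = 0) (f₀ : F) :
    ∃ φ : F → ZMod 2, φ f₀ = 0 ∧ ∀ d, z d = φ (face d) + φ (face (rev d)) := by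
  set f := (boundary tail).domRestrict (symmetricFunctions rev)
  set g := coboundary rev face hrev
  have hle : g.range ≤ f.ker := by
    rintro _ ⟨φ, rfl⟩
    rw [LinearMap.mem_ker]
    ext v
    have := sum_coboundary hrev htail hface φ v
    simp only [CharTwo.sub_eq_add] at this
    exact this
  have hg : Module.finrank (ZMod 2) g.ker ≤ 1 := by
    have h1 : g.ker ≤ Submodule.span (ZMod 2) {fun _ => 1} := by
      intro φ hφ
      rw [LinearMap.mem_ker] at hφ
      have h := hfaces φ fun d => by
        have := congrFun (congrArg Subtype.val hφ) d
        exact CharTwo.add_eq_zero.1 this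
      rw [Submodule.mem_span_singleton]
      exact ⟨φ f₀, by ext f; simp [h f f₀]⟩
    refine (Submodule.finrank_mono h1).trans ?_
    simpa using finrank_span_le_card (R := ZMod 2) ({fun _ => 1} : Set (F → ZMod 2))
  have h1 := f.finrank_range_add_finrank_ker
  have h2 := g.finrank_range_add_finrank_ker
  rw [Module.finrank_fintype_fun_eq_card] at h2
  have h3 := two_mul_finrank_symmetricFunctions_le hrev hO
  have h4 : _ ≤ Module.finrank (ZMod 2) f.range + 1 := card_le_finrank_range_boundary_add_one (tail := tail) hrev hconn
  -- Dimension count: the range of `g` has dimension at least `|F| - 1`, the kernel of `f` at most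
  -- `|X|/2 - |U| + 1`, and Euler's formula says that the latter does not exceed the former.
  have heq : g.range = f.ker := Submodule.eq_of_le_of_finrank_le hle (by omega)
  have hzk : (⟨z, hz⟩ : symmetricFunctions rev) ∈ f.ker := by
    rw [LinearMap.mem_ker]
    ext v
    exact hz' v
  rw [← heq] at hzk
  obtain ⟨φ, hφ⟩ := hzk
  -- Adding a constant to `φ` changes nothing on an edge, since it is counted on both sides.
  refine ⟨fun f => φ f - φ f₀, sub_self _, fun d => ?_⟩
  have := congrFun (congrArg Subtype.val hφ) d
  change φ (face d) + φ (face (rev d)) = z d at this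
  rw [← this]
  linear_combination (φ f₀) * (CharTwo.two_eq_zero (R := ZMod 2))

end RotationSystem

/-! ### Planar components -/

namespace ComponentTree

open SimpleGraph

variable {V ι : Type*} {G : SimpleGraph V} {D : ComponentTree G ι} {N M M' : ι}

namespace CDart

variable (d : D.CDart N)

theorem tail_rev : tail (rev d) = head d := by rcases d with d | x <;> rfl

theorem head_rev : head (rev d) = tail d := by rcases d with d | x <;> rfl

theorem tail_ne_head : tail d ≠ head d := by
  rcases d with d | x
  · exact d.1.adj.ne
  · exact x.2.2.2.2

theorem tail_mem_bag : tail d ∈ D.bag N := by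
  rcases d with ⟨d, rfl⟩ | x
  · exact D.fst_mem_bag d
  · exact x.2.2.1.1

variable {d}

theorem isVirtualAt_rev : IsVirtualAt M (rev d) ↔ IsVirtualAt M d := by
  rcases d with d | x <;> rfl

theorem IsVirtualAt.eq (h : IsVirtualAt M d) (h' : IsVirtualAt M' d) : M = M' := by
  rcases d with d | x
  · exact h.elim
  · exact Eq.trans (Eq.symm h) h'

theorem IsVirtualAt.adj (h : IsVirtualAt M d) : D.tree.Adj N M := by
  rcases d with d | ⟨⟨M, x, y⟩, hx⟩
  · exact h.elim
  · obtain rfl := h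
    exact hx.1

theorem IsVirtualAt.tail_mem (h : IsVirtualAt M d) : tail d ∈ D.sep N M := by
  rcases d with d | ⟨⟨M, x, y⟩, hx⟩
  · exact h.elim
  · obtain rfl := h
    exact hx.2.1

theorem IsVirtualAt.head_mem (h : IsVirtualAt M d) : head d ∈ D.sep N M :=
  tail_rev d ▸ (isVirtualAt_rev.2 h).tail_mem

theorem IsVirtualAt.ext {e : D.CDart N} (h : IsVirtualAt M d) (h' : IsVirtualAt M e)
    (ht : tail d = tail e) (hh : head d = head e) : d = e := by
  rcases d with d | ⟨⟨M, x, y⟩, hx⟩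
  · exact h.elim
  rcases e with e | ⟨⟨M', x', y'⟩, hx'⟩
  · exact h'.elim
  obtain rfl := h
  obtain rfl := h'
  obtain rfl : x = x' := ht
  obtain rfl : y = y' := hh
  rfl

theorem exists_isVirtualAt (hM : D.tree.Adj N M) {x y : V} (hx : x ∈ D.sep N M)
    (hy : y ∈ D.sep N M) (hxy : x ≠ y) :
    ∃ d : D.CDart N, IsVirtualAt M d ∧ tail d = x ∧ head d = y :=
  ⟨.inr ⟨(M, x, y), hM, hx, hy, hxy⟩, rfl, rfl, rfl⟩

theorem weight_rev {w : G.Dart → ℤ} (hw : IsSkew w) : weight w (rev d) = - weight w d := by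
  rcases d with d | x
  · exact hw d.1
  · exact (neg_zero).symm

theorem rev_involutive : Function.Involutive (rev : D.CDart N → D.CDart N) := rev_rev

theorem rev_ne : rev d ≠ d := fun h => tail_ne_head d (by rw [← tail_rev, h])

end CDart

open CDart

theorem finite_dart [Finite V] : Finite G.Dart :=
  Finite.of_injective (fun d : G.Dart => d.toProd) fun _ _ h => Dart.ext _ _ h

theorem finite_cDart [Finite V] [Finite ι] : Finite (D.CDart N) := by
  have : Finite G.Dart := finite_dart
  infer_instance

theorem ncard_isVirtualAt_le [Finite V] {n : ℕ} (hn : (D.sep N M).ncard = n) :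
    {d : D.CDart N | IsVirtualAt M d}.ncard ≤ n * n - n := by
  classical
  have hcard := Set.ncard_eq_toFinset_card (D.sep N M)
  set s := (Set.toFinite (D.sep N M)).toFinset with hs
  have h1 : {d : D.CDart N | IsVirtualAt M d}.ncard ≤ (s.offDiag : Set (V × V)).ncard := by
    refine Set.ncard_le_ncard_of_injOn (fun d => (tail d, head d)) ?_ ?_ (Finset.finite_toSet _)
    · intro d hd
      have hd' : IsVirtualAt M d := hd
      simpa [hs] using ⟨hd'.tail_mem, hd'.head_mem, tail_ne_head d⟩
    · intro d hd e he h
      exact IsVirtualAt.ext hd he (Prod.ext_iff.1 h).1 (Prod.ext_iff.1 h).2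
  rw [Set.ncard_coe_finset, Finset.offDiag_card, ← hcard, hn] at h1
  exact h1

namespace PlanarEmbedding

variable (E : D.PlanarEmbedding N)

theorem tail_rot (d : D.CDart N) : tail (E.rot d) = tail d :=
  (E.rot_sameCycle _ _).1 (Equiv.Perm.sameCycle_apply_left.2 (Equiv.Perm.SameCycle.refl _ _))

theorem face_rot_rev (d : D.CDart N) : E.face (E.rot (rev d)) = E.face d :=
  Quotient.sound (s := Equiv.Perm.SameCycle.setoid (D.facePerm N E.rot))
    ((Equiv.Perm.sameCycle_apply_left (f := D.facePerm N E.rot)).2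
      (Equiv.Perm.SameCycle.refl (D.facePerm N E.rot) d))

theorem face_rot (d : D.CDart N) : E.face (E.rot d) = E.face (rev d) := by
  rw [← E.face_rot_rev (rev d), rev_rev]

theorem exists_face_eq (f : E.Face) : ∃ d, E.face d = f := Quotient.exists_rep f

variable {E}

/-- Every directed edge can be reached from any other one by rotation and reversal. -/
theorem dart_induction [Finite V] [Finite ι] {P : D.CDart N → Prop} (hrev : ∀ d, P d → P (rev d))
    (hrot : ∀ d, P d → P (E.rot d)) {d : D.CDart N} (hd : P d) (e : D.CDart N) : P e := by
  have : Finite (D.CDart N) := finite_cDart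
  have key : ∀ a b, P a → tail a = tail b → P b := by
    intro a b ha hab
    obtain ⟨n, -, rfl⟩ := ((E.rot_sameCycle a b).2 hab).exists_pow_eq'
    clear hab
    induction n with
    | zero => exact ha
    | succ n ih =>
      rw [pow_succ', Equiv.Perm.mul_apply]
      exact hrot _ ih
  have h : ∀ v, Relation.ReflTransGen
      (fun a b => ∃ d : D.CDart N, tail d = a ∧ head d = b) (tail d) v →
      ∀ e, tail e = v → P e := by
    intro v hv
    induction hv with
    | refl => exact fun e he => key d e hd he.symm
    | tail _ hbc ih =>
      obtain ⟨a, ha, rfl⟩ := hbc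
      intro e he
      exact key (rev a) e (hrev a (ih a ha)) ((tail_rev a).trans he.symm)
  exact h _ (E.connected _ (tail_mem_bag d) _ (tail_mem_bag e)) e rfl

/-- A function on the faces that agrees on the two sides of every edge is constant. -/
theorem eq_of_forall_face_eq [Finite V] [Finite ι] {α : Type*} {φ : E.Face → α}
    (h : ∀ d, φ (E.face d) = φ (E.face (rev d))) (f g : E.Face) : φ f = φ g := by
  obtain ⟨d, rfl⟩ := E.exists_face_eq f
  obtain ⟨e, rfl⟩ := E.exists_face_eq g
  refine dart_induction (E := E) (P := fun e => φ (E.face d) = φ (E.face e)) (fun a ha => ?_)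
    (fun a ha => ?_) rfl e
  · rw [ha, h]
  · rw [ha, h, face_rot]

/-! ### Virtual triangles -/

/-- A triangle face has a directed edge, but not its reverse. -/
theorem face_rev_ne (hM : D.tree.Adj N M) {d : D.CDart N} (hf : IsTriangleFace E.rot M (E.face d)) :
    E.face (rev d) ≠ E.face d := by
  intro h
  obtain ⟨h3, hc, hv⟩ := hf
  have hfin : {e | rotFace E.rot e = E.face d}.Finite :=
    Set.finite_of_ncard_ne_zero (by rw [hc]; norm_num)
  have hsep : (D.sep N M).Finite := Set.finite_of_ncard_ne_zero (by rw [h3]; norm_num)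
  have hdM : IsVirtualAt M d := hv d rfl
  -- The third vertex of the triplet provides a second edge leaving the tail of `e`, so the rotation
  -- there is not trivial.
  have hne : ∀ e : D.CDart N, IsVirtualAt M e → E.rot e ≠ e := by
    intro e he hrot
    obtain ⟨y, hy, hye⟩ : ∃ y ∈ D.sep N M, y ∉ ({tail e, head e} : Set V) := by
      by_contra! h'
      have := (Set.ncard_le_ncard (s := D.sep N M) (t := {tail e, head e}) h').trans
        (Set.ncard_insert_le _ _)
      rw [Set.ncard_singleton, h3] at this
      omega
    simp only [Set.mem_insert_iff, Set.mem_singleton_iff, not_or] at hye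
    obtain ⟨a, -, ha, hay⟩ := exists_isVirtualAt hM he.tail_mem hy (Ne.symm hye.1)
    have := (E.rot_sameCycle e a).2 ha.symm
    obtain ⟨n, hn⟩ := this
    rw [Equiv.Perm.zpow_apply_eq_self_of_apply_eq_self hrot] at hn
    exact hye.2 (hay.symm.trans (hn ▸ rfl))
  have h1 : E.face (E.rot (rev d)) = E.face d := E.face_rot_rev d
  have h2 : E.face (E.rot d) = E.face d := (E.face_rot d).trans h
  have ht1 : tail (E.rot (rev d)) = head d := (E.tail_rot _).trans (tail_rev d)
  have ht2 : tail (E.rot d) = tail d := E.tail_rot d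
  have hth := tail_ne_head d
  have hn1 := hne d hdM
  have hn2 := hne (rev d) (isVirtualAt_rev.2 hdM)
  -- If both directions of `d` bordered the face, so would the edges following them on its boundary.
  -- These are four distinct directed edges, but the triangle has three.
  have hsub : ({E.rot d, E.rot (rev d), d, rev d} : Set (D.CDart N)) ⊆
      {e | rotFace E.rot e = E.face d} := by
    rintro e (rfl | rfl | rfl | rfl)
    exacts [h2, h1, rfl, h]
  have h4 : ({E.rot d, E.rot (rev d), d, rev d} : Set (D.CDart N)).ncard = 4 := by
    rw [Set.ncard_insert_of_notMem, Set.ncard_insert_of_notMem, Set.ncard_pair (Ne.symm rev_ne)]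
    · rintro (h' | h')
      · exact hth ((congrArg tail h').symm.trans ht1)
      · exact hn2 h'
    · rintro (h' | h' | h')
      · exact hth (ht2.symm.trans ((congrArg tail h').trans ht1))
      · exact hn1 h'
      · exact hth (ht2.symm.trans ((congrArg tail h').trans (tail_rev d)))
  have := Set.ncard_le_ncard hsub hfin
  omega

/-- Every virtual edge of a triangle borders its triangle face. -/
theorem face_eq_or_face_rev_eq [Finite V] [Finite ι] {f : E.Face}
    (hf : IsTriangleFace E.rot M f) {d : D.CDart N} (hd : IsVirtualAt M d) :
    E.face d = f ∨ E.face (rev d) = f := by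
  have : Finite (D.CDart N) := finite_cDart
  have hc := hf.2.1
  have hv := hf.2.2
  set T : Set (D.CDart N) := {e | rotFace E.rot e = f}
  have hdisj : Disjoint T (rev '' T) := by
    rw [Set.disjoint_left]
    rintro _ he ⟨e, he', rfl⟩
    have he1 : E.face e = f := he'
    have he2 : E.face (rev e) = f := he
    exact face_rev_ne (E := E) (hv e he').adj (d := e) (he1 ▸ hf) (he2.trans he1.symm)
  -- Three vertices span only six directed virtual edges, so the triangle face and its reverses
  -- exhaust them.
  have h6 : (T ∪ rev '' T).ncard = 6 := by
    rw [Set.ncard_union_eq hdisj, Set.ncard_image_of_injective _ rev_involutive.injective, hc]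
  have hsub : T ∪ rev '' T ⊆ {d : D.CDart N | IsVirtualAt M d} := by
    rintro _ (he | ⟨e, he, rfl⟩)
    · exact hv _ he
    · exact isVirtualAt_rev.2 (hv e he)
  have heq := Set.eq_of_subset_of_ncard_le hsub (by
    rw [h6]
    exact ncard_isVirtualAt_le hf.1)
  have hd' : d ∈ T ∪ rev '' T := heq ▸ hd
  rcases hd' with h | ⟨e, he, rfl⟩
  · exact .inl h
  · exact .inr (by rw [rev_rev]; exact he)

/-- If there were two such faces, crossing any edge of one would lead to the other. The two would
then be all the faces of the connected component, leaving no room for the outer face, which is not a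
triangle. -/
theorem triangleFace_unique [Finite V] [Finite ι] (hM : D.tree.Adj N M) {f g : E.Face}
    (hf : IsTriangleFace E.rot M f) (hg : IsTriangleFace E.rot M g) : f = g := by
  by_contra hfg
  have key : ∀ f g : E.Face, IsTriangleFace E.rot M f → IsTriangleFace E.rot M g → f ≠ g →
      ∀ e, E.face e = f → E.face (rev e) = g := by
    intro f g hf hg hfg e he
    rcases face_eq_or_face_rev_eq hg (hf.2.2 e he) with h | h
    · exact absurd (he.symm.trans h) hfg
    · exact h
  obtain ⟨d, hd⟩ := E.exists_face_eq f
  obtain ⟨e, he⟩ := E.exists_face_eq E.outer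
  have hrev : ∀ a, (E.face a = f ∨ E.face a = g) → E.face (rev a) = f ∨ E.face (rev a) = g := by
    rintro a (ha | ha)
    · exact .inr (key f g hf hg hfg a ha)
    · exact .inl (key g f hg hf (Ne.symm hfg) a ha)
  have := dart_induction (E := E) (P := fun a => E.face a = f ∨ E.face a = g) hrev
    (fun a ha => by rw [face_rot]; exact hrev a ha) (.inl hd) e
  rcases this with h | h
  · exact E.outer_not_triangle M hM (by rw [← he, h]; exact hf)
  · exact E.outer_not_triangle M hM (by rw [← he, h]; exact hg)

theorem IsTriangleFace.eq {f : E.Face} (hf : IsTriangleFace E.rot M f)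
    {d : D.CDart N} (hd : E.face d = f) (hd' : IsVirtualAt M' d) : M = M' :=
  (hf.2.2 d hd).eq hd'

/-- Only one of the two faces at a virtual edge can be a virtual triangle. -/
theorem not_isTriangleFace_rev [Finite V] [Finite ι] {d : D.CDart N}
    (hf : IsTriangleFace E.rot M (E.face d)) : ¬ IsTriangleFace E.rot M' (E.face (rev d)) := by
  intro h
  have hd : IsVirtualAt M d := hf.2.2 d rfl
  obtain rfl : M' = M := (h.2.2 _ rfl).eq (isVirtualAt_rev.2 hd)
  exact face_rev_ne hd.adj hf (triangleFace_unique hd.adj h hf)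

/-- A virtual triangle or edge is adjacent to at most three faces. -/
theorem ncard_adjacentTo_le [Finite V] [Finite ι] (E : D.PlanarEmbedding N)
    (hM : D.tree.Adj N M) : {f | E.AdjacentTo f M}.ncard ≤ 3 := by
  have : Finite (D.CDart N) := finite_cDart
  rcases D.sep_card N M hM with h | h
  · have hsub : {f | E.AdjacentTo f M} ⊆ E.face '' {d : D.CDart N | IsVirtualAt M d} := by
      rintro f ⟨⟨d, hd, rfl⟩, -⟩
      exact ⟨d, hd, rfl⟩
    have h1 := Set.ncard_le_ncard hsub (Set.toFinite _)
    have h2 := Set.ncard_image_le (f := E.face) (Set.toFinite {d : D.CDart N | IsVirtualAt M d})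
    have h3 := ncard_isVirtualAt_le (N := N) h
    omega
  · obtain ⟨T, hT⟩ := E.triangle_face M hM h
    -- An adjacent face other than the triangle lies across one of its three edges.
    have hsub : {f | E.AdjacentTo f M} ⊆
        (fun d => E.face (rev d)) '' {d : D.CDart N | rotFace E.rot d = T} := by
      rintro f ⟨⟨d, hd, rfl⟩, hf⟩
      rcases face_eq_or_face_rev_eq hT hd with h' | h'
      · exact absurd (h' ▸ hT) hf
      · exact ⟨rev d, h', by simp only [rev_rev]⟩
    have h1 := Set.ncard_le_ncard hsub (Set.toFinite _)
    have h2 := Set.ncard_image_le (f := fun d => E.face (rev d))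
      (Set.toFinite {d : D.CDart N | rotFace E.rot d = T})
    have h3 := hT.2.1
    omega

end PlanarEmbedding

end ComponentTree

/-! ### The projection of a cycle as a sum of faces -/

namespace ComponentTree

open SimpleGraph CDart

variable {V ι : Type*} {G : SimpleGraph V} {D : ComponentTree G ι}
  {N M M' : ι} {Q : Finset G.Dart}

open Classical in
/-- A sum over directed edges that is supported on the edges of a cycle. -/
theorem sum_dart_eq [Fintype V] {A : Type*} [AddCommMonoid A] (hQ : IsCycleDarts Q) (g : G.Dart → A)
    (hg : ∀ d, d ∉ Q → d.symm ∉ Q → g d = 0) : ∑ d, g d = ∑ d ∈ Q, (g d + g d.symm) := by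
  have hdisj : Disjoint Q (Q.image Dart.symm) := by
    rw [Finset.disjoint_left]
    intro d hd hd'
    obtain ⟨e, he, rfl⟩ := Finset.mem_image.1 hd'
    exact hQ.symm_notMem e he hd
  rw [Finset.sum_add_distrib, ← Finset.sum_image (g := Dart.symm) (s := Q) (f := g)
    (fun a _ b _ h => Dart.symm_involutive.injective h), ← Finset.sum_union hdisj]
  refine (Finset.sum_subset (Finset.subset_univ _) fun d _ hd => ?_).symm
  rw [Finset.mem_union, not_or] at hd
  refine hg d hd.1 fun h => hd.2 ?_
  exact Finset.mem_image.2 ⟨d.symm, h, d.symm_symm⟩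

theorem sum_subtype_eq_sum_dite {α A : Type*} [Fintype α] [AddCommMonoid A] (p : α → Prop)
    [DecidablePred p] [Fintype {a // p a}] (f : {a // p a} → A) :
    ∑ a, f a = ∑ a, if h : p a then f ⟨a, h⟩ else 0 := by
  have h := Finset.sum_subtype (p := p) (F := ‹Fintype {a // p a}›) (Finset.univ.filter p) (by simp)
    (fun a => if h : p a then f ⟨a, h⟩ else 0)
  rw [Finset.sum_filter_of_ne fun a _ h => by_contra fun h' => h (dif_neg h')] at h
  rw [h]
  exact Finset.sum_congr rfl fun a _ => by rw [dif_pos a.2]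

open Classical in
/-- A sum over the directed edges of a component, split into real and virtual edges. -/
theorem sum_cDart [Fintype V] [Fintype ι] {A : Type*} [AddCommMonoid A] (f : D.CDart N → A) :
    ∑ d, f d = (∑ d : G.Dart, if h : D.dartHome d = N then f (.inl ⟨d, h⟩) else 0) +
      ∑ M, ∑ x, ∑ y, if h : D.tree.Adj N M ∧ x ∈ D.sep N M ∧ y ∈ D.sep N M ∧ x ≠ y then
        f (.inr ⟨(M, x, y), h⟩) else 0 := by
  rw [Fintype.sum_sum_type, sum_subtype_eq_sum_dite, sum_subtype_eq_sum_dite,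
    Fintype.sum_prod_type]
  simp_rw [Fintype.sum_prod_type]

open Classical in
-- `N` and its sides partition the components, so the cycle enters as many of these parts as it
-- leaves.
theorem entry_add_sum_entry [Fintype ι] (hQ : IsCycleDarts Q) (N : ι) (v : V) :
    D.entry Q {N} v + ∑ M with D.tree.Adj N M, D.entry Q (D.side N M) v = 0 := by
  rcases hQ.vertex_cases v with h | ⟨d, hd, d', hd', h, rfl⟩
  · simp [entry_eq_zero_of_notMem hQ h]
  · simp_rw [entry_eq hQ hd hd' h, Finset.sum_sub_distrib, Set.mem_singleton_iff]
    have key : ∀ P, (if P = N then 1 else 0) +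
        (∑ M with D.tree.Adj N M, if P ∈ D.side N M then (1 : ℤ) else 0) = 1 := by
      intro P
      rcases sum_side (D := D) N P (fun _ => 1) with ⟨h1, h2⟩ | ⟨h1, M, -, -, h2⟩
      · rw [h2, if_pos h1, add_zero]
      · rw [h2, if_neg h1, zero_add]
    linarith [key (D.dartHome d'), key (D.dartHome d)]

open Classical in
/-- The projection of a cycle on a component, as a set of edges given by its indicator. The virtual
edge between two vertices of a separating set belongs to it if the cycle crosses from the component
to the other side at both of them. -/
noncomputable def projectionIndicator (D : ComponentTree G ι) (Q : Finset G.Dart) (N : ι) :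
    D.CDart N → ZMod 2
  | .inl d => if d.1 ∈ Q ∨ d.1.symm ∈ Q then 1 else 0
  | .inr x => ((D.entry Q (D.side N x.1.1) x.1.2.1 * D.entry Q (D.side N x.1.1) x.1.2.2 : ℤ) :
      ZMod 2)

theorem projectionIndicator_rev (d : D.CDart N) :
    D.projectionIndicator Q N (rev d) = D.projectionIndicator Q N d := by
  rcases d with d | x
  · by_cases h1 : d.1 ∈ Q <;> by_cases h2 : d.1.symm ∈ Q <;>
      simp [projectionIndicator, rev, h1, h2]
  · simp only [projectionIndicator, rev]
    rw [mul_comm]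

theorem intCast_entry_sq (hQ : IsCycleDarts Q) (W : Set ι) (v : V) :
    ((-(D.entry Q W v * D.entry Q W v) : ℤ) : ZMod 2) = (D.entry Q W v : ZMod 2) := by
  rcases entry_values (D := D) hQ W v with h | h | h <;> rw [h] <;> decide

open Classical in
-- Modulo two, the real edges at `v` contribute the entry into `N`, and the virtual edges at `M` the
-- entry into the side of `M`; all these entries cancel by `entry_add_sum_entry`.
theorem sum_projectionIndicator [Fintype V] [Fintype ι] (hQ : IsCycleDarts Q) (v : V) :
    (∑ d : D.CDart N, if tail d = v then D.projectionIndicator Q N d else 0) = 0 := by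
  have hreal : (∑ d : G.Dart, if h : D.dartHome d = N then
      (if tail (N := N) (.inl ⟨d, h⟩ : D.CDart N) = v then
        D.projectionIndicator Q N (.inl ⟨d, h⟩) else 0) else 0) =
      ((D.entry Q {N} v : ℤ) : ZMod 2) := by
    rw [sum_dart_eq hQ _ fun d h1 h2 => by simp [projectionIndicator, h1, h2], entry,
      Int.cast_sum]
    refine Finset.sum_congr rfl fun d hd => ?_
    have h1 : D.dartHome d.symm = N ↔ D.dartHome d = N := by rw [dartHome_symm]
    by_cases hN : D.dartHome d = N
    · have hN' := h1.2 hN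
      simp only [hN, hN', dif_pos, projectionIndicator, hd, Dart.symm_symm, or_true, true_or,
        if_true, tail, Set.mem_singleton_iff]
      change (if d.fst = v then (1 : ZMod 2) else 0) + (if d.snd = v then 1 else 0) = _
      push_cast
      rw [CharTwo.sub_eq_add]
    · have hN' := fun h => hN (h1.1 h)
      rw [dif_neg hN, dif_neg hN', if_neg (by simpa using hN)]
      simp
  have hvirt : ∀ M, (∑ x, ∑ y, if h : D.tree.Adj N M ∧ x ∈ D.sep N M ∧ y ∈ D.sep N M ∧ x ≠ y then
      (if tail (N := N) (.inr ⟨(M, x, y), h⟩ : D.CDart N) = v then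
        D.projectionIndicator Q N (.inr ⟨(M, x, y), h⟩) else 0) else 0) =
      if D.tree.Adj N M then ((D.entry Q (D.side N M) v : ℤ) : ZMod 2) else 0 := by
    intro M
    by_cases hM : D.tree.Adj N M
    · rw [if_pos hM, ← intCast_entry_sq hQ]
      have h1 : ∀ x y, (if h : D.tree.Adj N M ∧ x ∈ D.sep N M ∧ y ∈ D.sep N M ∧ x ≠ y then
          (if tail (N := N) (.inr ⟨(M, x, y), h⟩ : D.CDart N) = v then
            D.projectionIndicator Q N (.inr ⟨(M, x, y), h⟩) else 0) else 0) =
          if x = v then (((if y = v then 0 else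
            D.entry Q (D.side N M) v * D.entry Q (D.side N M) y : ℤ)) : ZMod 2) else 0 := by
        intro x y
        by_cases hx : x = v
        · subst hx
          by_cases hy : y = x
          · simp [hy]
          · rw [if_pos rfl, if_neg hy]
            split_ifs with h h'
            · rfl
            · exact absurd rfl h'
            · by_contra hne
              refine h ⟨hM, mem_sep_of_entry_ne_zero hQ hM fun h0 => hne ?_,
                mem_sep_of_entry_ne_zero hQ hM fun h0 => hne ?_, Ne.symm hy⟩
              · simp [h0]
              · simp [h0]
        · rw [if_neg hx]
          split_ifs with h h'
          · exact absurd h' hx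
          · rfl
          · rfl
      simp_rw [h1]
      rw [Finset.sum_comm]
      simp only [Finset.sum_ite_eq', Finset.mem_univ, if_true]
      rw [← Int.cast_sum]
      congr 1
      -- The sum over all `y` vanishes, so the sum over `y ≠ v` is minus the square of the entry at
      -- `v`, which has the same parity as that entry.
      have h2 : ∑ y, D.entry Q (D.side N M) v * D.entry Q (D.side N M) y = 0 := by
        rw [← Finset.mul_sum, sum_entry, mul_zero]
      rw [← Finset.add_sum_erase _ _ (Finset.mem_univ v)] at h2 ⊢
      rw [if_pos rfl, zero_add, Finset.sum_congr rfl fun y hy =>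
        if_neg (Finset.ne_of_mem_erase hy)]
      linarith
    · simp [hM]
  rw [sum_cDart, hreal]
  simp_rw [hvirt]
  rw [← Finset.sum_filter, ← Int.cast_sum, ← Int.cast_add, entry_add_sum_entry hQ, Int.cast_zero]

open Classical in
-- The row sums of a skew matrix add up to zero. Here they can be nonzero only at the one vertex
-- with `b = 1` and the one with `b = -1`, so they are opposite there.
theorem exists_sum_eq_mul [Fintype V] {b : V → ℤ} (hb : ∀ x, b x = 0 ∨ b x = 1 ∨ b x = -1)
    (h1 : ∀ x y, b x = 1 → b y = 1 → x = y) (h2 : ∀ x y, b x = -1 → b y = -1 → x = y)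
    {ζ : V → V → ℤ} (hskew : ∀ x y, ζ y x = - ζ x y) (hsupp : ∀ x y, b x = 0 → ζ x y = 0) :
    ∃ c, ∀ v, ∑ y, ζ v y = b v * c := by
  have htot : ∑ x, ∑ y, ζ x y = 0 := by
    have : ∑ x, ∑ y, ζ x y = - ∑ x, ∑ y, ζ x y := by
      nth_rw 1 [Finset.sum_comm]
      simp only [← Finset.sum_neg_distrib]
      exact Finset.sum_congr rfl fun x _ => Finset.sum_congr rfl fun y _ => hskew x y
    omega
  have hsplit : ∑ x, ∑ y, ζ x y = (∑ x, if b x = 1 then ∑ y, ζ x y else 0) +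
      ∑ x, if b x = -1 then ∑ y, ζ x y else 0 := by
    rw [← Finset.sum_add_distrib]
    refine Finset.sum_congr rfl fun x _ => ?_
    rcases hb x with h | h | h
    · simp [h, Finset.sum_eq_zero fun y _ => hsupp x y h]
    · simp [h]
    · simp [h]
  refine ⟨∑ x, if b x = 1 then ∑ y, ζ x y else 0, fun v => ?_⟩
  rcases hb v with h | h | h
  · rw [h, zero_mul, Finset.sum_eq_zero fun y _ => hsupp v y h]
  · rw [h, one_mul]
    symm
    rw [Finset.sum_eq_single v]
    · rw [if_pos h]
    · exact fun x _ hx => if_neg fun hx' => hx (h1 x v hx' h)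
    · simp
  · have : (∑ x, if b x = -1 then ∑ y, ζ x y else 0) = ∑ y, ζ v y := by
      rw [Finset.sum_eq_single v]
      · rw [if_pos h]
      · exact fun x _ hx => if_neg fun hx' => hx (h2 x v hx' h)
      · simp
    rw [h]
    linarith

open Classical in
/-- A flow on a component that is supported on the projection of a cycle is constant along it. -/
theorem exists_flow_eq [Fintype V] [Fintype ι] (hQ : IsCycleDarts Q) {Z : D.CDart N → ℤ} (hskew : ∀ d, Z (rev d) = - Z d)
    (hdiv : ∀ v, (∑ d, if tail d = v then Z d else 0) = 0)
    (hsupp : ∀ d, D.projectionIndicator Q N d = 0 → Z d = 0) :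
    ∃ ρ, ∀ d ∈ Q, ∀ h : D.dartHome d = N, Z (.inl ⟨d, h⟩) = ρ := by
  set ξ : G.Dart → ℤ := fun d => if h : D.dartHome d = N then Z (.inl ⟨d, h⟩) else 0 with hξ
  set ζ : ι → V → V → ℤ := fun M x y =>
    if h : D.tree.Adj N M ∧ x ∈ D.sep N M ∧ y ∈ D.sep N M ∧ x ≠ y then
      Z (.inr ⟨(M, x, y), h⟩) else 0 with hζ
  have hξskew : ∀ d, ξ d.symm = - ξ d := by
    intro d
    by_cases h : D.dartHome d = N
    · have h' : D.dartHome d.symm = N := (D.dartHome_symm d).trans h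
      simp only [hξ, dif_pos h, dif_pos h']
      exact hskew (.inl ⟨d, h⟩)
    · have h' : ¬ D.dartHome d.symm = N := fun h' => h ((D.dartHome_symm d).symm.trans h')
      simp [hξ, h, h']
  have hξsupp : ∀ d, d ∉ Q → d.symm ∉ Q → ξ d = 0 := by
    intro d h1 h2
    by_cases h : D.dartHome d = N
    · simp only [hξ, dif_pos h]
      exact hsupp _ (by simp [projectionIndicator, h1, h2])
    · simp [hξ, h]
  -- The virtual flow at `M` amounts to one number `c M`: the flow that the cycle would carry on the
  -- side of `M`.
  have hc : ∀ M, ∃ c, D.tree.Adj N M → ∀ v, ∑ y, ζ M v y = D.entry Q (D.side N M) v * c := by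
    intro M
    by_cases hM : D.tree.Adj N M
    · have hζskew : ∀ x y, ζ M y x = - ζ M x y := by
        intro x y
        by_cases h : D.tree.Adj N M ∧ x ∈ D.sep N M ∧ y ∈ D.sep N M ∧ x ≠ y
        · have h' : D.tree.Adj N M ∧ y ∈ D.sep N M ∧ x ∈ D.sep N M ∧ y ≠ x :=
            ⟨h.1, h.2.2.1, h.2.1, h.2.2.2.symm⟩
          simp only [hζ, dif_pos h, dif_pos h']
          exact hskew (.inr ⟨(M, x, y), h⟩)
        · have h' : ¬ (D.tree.Adj N M ∧ y ∈ D.sep N M ∧ x ∈ D.sep N M ∧ y ≠ x) := fun h' =>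
            h ⟨h'.1, h'.2.2.1, h'.2.1, h'.2.2.2.symm⟩
          simp only [hζ, dif_neg h, dif_neg h', neg_zero]
      have hζsupp : ∀ x y, D.entry Q (D.side N M) x = 0 → ζ M x y = 0 := by
        intro x y hx
        by_cases h : D.tree.Adj N M ∧ x ∈ D.sep N M ∧ y ∈ D.sep N M ∧ x ≠ y
        · simp only [hζ, dif_pos h]
          exact hsupp _ (by simp [projectionIndicator, hx])
        · simp only [hζ, dif_neg h]
      obtain ⟨c, hc⟩ := exists_sum_eq_mul (entry_values hQ (D.side N M))
        (fun x y => eq_of_entry_eq_one hQ hM) (fun x y => eq_of_entry_eq_neg_one hQ hM)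
        hζskew hζsupp
      exact ⟨c, fun _ => hc⟩
    · exact ⟨0, fun h => absurd h hM⟩
  choose c hc using hc
  -- Assign to an edge of the cycle its own flow if it is in `N`, and the number of its side
  -- otherwise. Conservation at the common vertex says that consecutive edges are assigned the same
  -- value.
  have hstep : ∀ d ∈ Q, ∀ d' ∈ Q, d.snd = d'.fst →
      ξ d + (∑ M with D.tree.Adj N M, if D.dartHome d ∈ D.side N M then c M else 0) =
      ξ d' + ∑ M with D.tree.Adj N M, if D.dartHome d' ∈ D.side N M then c M else 0 := by
    intro d hd d' hd' h
    have h1 := hdiv d'.fst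
    rw [sum_cDart] at h1
    have h2 : (∑ e : G.Dart, if h : D.dartHome e = N then
        (if tail (.inl ⟨e, h⟩ : D.CDart N) = d'.fst then Z (.inl ⟨e, h⟩) else 0) else 0) =
        ξ d' - ξ d := by
      have h3 : ∀ e : G.Dart, (if h : D.dartHome e = N then
          (if tail (.inl ⟨e, h⟩ : D.CDart N) = d'.fst then Z (.inl ⟨e, h⟩) else 0) else 0) =
          if e.fst = d'.fst then ξ e else 0 := by
        intro e
        by_cases h : D.dartHome e = N
        · simp only [hξ, dif_pos h]
          rfl
        · simp [hξ, h]
      simp_rw [h3]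
      rw [sum_dart_eq hQ _ fun e h1 h2 => by simp [hξsupp e h1 h2], Finset.sum_add_distrib,
        sum_ite_eq_of_injOn (g := fun e : G.Dart => e.fst) hQ.fst_inj hd', sub_eq_add_neg, ← h]
      congr 1
      refine Eq.trans ?_
        (sum_ite_eq_of_injOn (g := fun e : G.Dart => e.snd) hQ.snd_inj hd (fun e => - ξ e))
      refine Finset.sum_congr rfl fun e _ => ?_
      rw [hξskew]
      rfl
    have h4 : ∀ M, (∑ x, ∑ y,
        if h : D.tree.Adj N M ∧ x ∈ D.sep N M ∧ y ∈ D.sep N M ∧ x ≠ y then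
          (if tail (.inr ⟨(M, x, y), h⟩ : D.CDart N) = d'.fst then
            Z (.inr ⟨(M, x, y), h⟩) else 0) else 0) =
        if D.tree.Adj N M then
          (if D.dartHome d' ∈ D.side N M then c M else 0) -
            (if D.dartHome d ∈ D.side N M then c M else 0) else 0 := by
      intro M
      have h5 : ∀ x y, (if h : D.tree.Adj N M ∧ x ∈ D.sep N M ∧ y ∈ D.sep N M ∧ x ≠ y then
          (if tail (.inr ⟨(M, x, y), h⟩ : D.CDart N) = d'.fst then
            Z (.inr ⟨(M, x, y), h⟩) else 0) else 0) = if x = d'.fst then ζ M x y else 0 := by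
        intro x y
        by_cases h : D.tree.Adj N M ∧ x ∈ D.sep N M ∧ y ∈ D.sep N M ∧ x ≠ y
        · simp only [hζ, dif_pos h]
          rfl
        · simp [hζ, dif_neg h]
      simp_rw [h5]
      rw [Finset.sum_comm]
      simp only [Finset.sum_ite_eq', Finset.mem_univ, if_true]
      by_cases hM : D.tree.Adj N M
      · rw [hc M hM, entry_eq hQ hd hd' h, if_pos hM]
        split_ifs <;> ring
      · rw [if_neg hM]
        refine Finset.sum_eq_zero fun y _ => ?_
        simp [hζ, hM]
    rw [h2] at h1
    simp_rw [h4] at h1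
    rw [← Finset.sum_filter, Finset.sum_sub_distrib] at h1
    linarith
  set ρ : G.Dart → ℤ := fun d =>
    ξ d + ∑ M with D.tree.Adj N M, if D.dartHome d ∈ D.side N M then c M else 0 with hρ
  have hρN : ∀ d, ∀ h : D.dartHome d = N, ρ d = Z (.inl ⟨d, h⟩) := by
    intro d h
    simp only [hρ, hξ, dif_pos h]
    rcases sum_side (D := D) N (D.dartHome d) c with ⟨-, h2⟩ | ⟨h1, -⟩
    · rw [h2, add_zero]
    · exact absurd h h1
  by_cases hex : ∃ d ∈ Q, D.dartHome d = N
  · obtain ⟨d, hd, hdN⟩ := hex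
    refine ⟨Z (.inl ⟨d, hdN⟩), fun e he heN => ?_⟩
    rw [← hρN d hdN, ← hρN e heN]
    refine hQ.connected (fun e => ρ e = ρ d) ?_ d hd e he rfl
    intro a ha b hb hab
    have : ρ a = ρ b := hstep a ha b hb hab
    rw [this]
  · exact ⟨0, fun d hd h => absurd ⟨d, hd, h⟩ hex⟩

end ComponentTree

/-! ### Faces enclosed by the projection of a cycle on a planar component -/

namespace ComponentTree

open SimpleGraph CDart

variable {V ι : Type*} {G : SimpleGraph V} {D : ComponentTree G ι}
  {N M M' : ι} {Q : Finset G.Dart}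

theorem projectionIndicator_ne_zero_iff (hQ : IsCycleDarts Q) {d : D.CDart N}
    (hd : IsVirtualAt M d) : D.projectionIndicator Q N d ≠ 0 ↔
      D.entry Q (D.side N M) (tail d) ≠ 0 ∧ D.entry Q (D.side N M) (head d) ≠ 0 := by
  rcases d with d | ⟨⟨M, x, y⟩, hx⟩
  · exact hd.elim
  · obtain rfl := hd
    simp only [projectionIndicator, tail, head]
    rcases entry_values (D := D) hQ (D.side N M) x with h | h | h <;>
    rcases entry_values (D := D) hQ (D.side N M) y with h' | h' | h' <;>
    rw [h, h'] <;> decide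

/-- The projection of a cycle contains at most one edge of every virtual triangle. -/
theorem eq_or_eq_rev_of_projectionIndicator [Fintype V] (hQ : IsCycleDarts Q) {d e : D.CDart N}
    (hd : IsVirtualAt M d) (he : IsVirtualAt M e) (hd' : D.projectionIndicator Q N d ≠ 0)
    (he' : D.projectionIndicator Q N e ≠ 0) : e = d ∨ e = rev d := by
  rw [projectionIndicator_ne_zero_iff hQ hd] at hd'
  rw [projectionIndicator_ne_zero_iff hQ he] at he'
  have h1 : ∀ x y, D.entry Q (D.side N M) x = 1 → D.entry Q (D.side N M) y = 1 → x = y :=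
    fun x y => eq_of_entry_eq_one hQ hd.adj
  have h2 : ∀ x y, D.entry Q (D.side N M) x = -1 → D.entry Q (D.side N M) y = -1 → x = y :=
    fun x y => eq_of_entry_eq_neg_one hQ hd.adj
  -- The ends of either edge must be the unique vertex with entry `1` and the unique vertex with
  -- entry `-1`.
  have key : (tail e = tail d ∧ head e = head d) ∨ (tail e = head d ∧ head e = tail d) := by
    have e1 := (entry_values (D := D) hQ (D.side N M) (tail d)).resolve_left hd'.1
    have e2 := (entry_values (D := D) hQ (D.side N M) (head d)).resolve_left hd'.2
    have e3 := (entry_values (D := D) hQ (D.side N M) (tail e)).resolve_left he'.1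
    have e4 := (entry_values (D := D) hQ (D.side N M) (head e)).resolve_left he'.2
    have n1 := tail_ne_head d
    have n2 := tail_ne_head e
    rcases e1 with e1 | e1 <;> rcases e2 with e2 | e2 <;> rcases e3 with e3 | e3 <;>
      rcases e4 with e4 | e4 <;>
      first
      | exact absurd (h1 _ _ e1 e2) n1
      | exact absurd (h2 _ _ e1 e2) n1
      | exact absurd (h1 _ _ e3 e4) n2
      | exact absurd (h2 _ _ e3 e4) n2
      | exact .inl ⟨h1 _ _ e3 e1, h2 _ _ e4 e2⟩
      | exact .inl ⟨h2 _ _ e3 e1, h1 _ _ e4 e2⟩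
      | exact .inr ⟨h1 _ _ e3 e2, h2 _ _ e4 e1⟩
      | exact .inr ⟨h2 _ _ e3 e2, h1 _ _ e4 e1⟩
  rcases key with ⟨h3, h4⟩ | ⟨h3, h4⟩
  · exact .inl (he.ext hd h3 h4)
  · exact .inr (he.ext (isVirtualAt_rev.2 hd) (h3.trans (tail_rev d).symm)
      (h4.trans (head_rev d).symm))

/-- A cycle that meets both `N` and the side of its neighbour `M` projects to an edge of the
virtual clique shared with `M`. -/
theorem exists_projectionIndicator_ne_zero [Fintype V] (hQ : IsCycleDarts Q)
    (hM : D.tree.Adj N M) {d d' : G.Dart} (hd : d ∈ Q) (hd' : d' ∈ Q)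
    (h : D.dartHome d ∈ D.side N M) (h' : D.dartHome d' = N) :
    ∃ e : D.CDart N, IsVirtualAt M e ∧ D.projectionIndicator Q N e ≠ 0 := by
  obtain ⟨x, hx⟩ := exists_entry_ne_zero hQ hd hd' h fun h'' => ne_of_mem_side h'' h'
  have h0 := sum_entry (D := D) Q (D.side N M)
  -- The entries sum to zero, so a single one cannot be nonzero.
  obtain ⟨y, hyx, hy⟩ : ∃ y, y ≠ x ∧ D.entry Q (D.side N M) y ≠ 0 := by
    by_contra! h1
    rw [Finset.sum_eq_single x (fun y _ hy => h1 y hy) (by simp)] at h0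
    exact hx h0
  obtain ⟨e, he, rfl, rfl⟩ := exists_isVirtualAt hM (mem_sep_of_entry_ne_zero hQ hM hx)
    (mem_sep_of_entry_ne_zero hQ hM hy) (Ne.symm hyx)
  exact ⟨e, he, (projectionIndicator_ne_zero_iff hQ he).2 ⟨hx, hy⟩⟩

namespace PlanarEmbedding

variable (E : D.PlanarEmbedding N)

open Classical in
/-- In a planar component, every even set of edges is the boundary of a set of inner faces. -/
theorem exists_boundary_eq [Fintype V] [Fintype ι] {z : D.CDart N → ZMod 2}
    (hz : ∀ d, z (rev d) = z d) (hz' : ∀ v, (∑ d, if tail d = v then z d else 0) = 0) :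
    ∃ φ : E.Face → ZMod 2, φ E.outer = 0 ∧ ∀ d, z d = φ (E.face d) + φ (E.face (rev d)) := by
  have : Fintype E.Face := Fintype.ofFinite _
  have hU : Nonempty (D.bag N) := by
    obtain ⟨d, -⟩ := E.exists_face_eq E.outer
    exact ⟨⟨tail d, tail_mem_bag d⟩⟩
  have hconn : ∀ u v : D.bag N, Relation.ReflTransGen (fun a b => ∃ d : D.CDart N,
      (⟨tail d, tail_mem_bag d⟩ : D.bag N) = a ∧
        (⟨tail (rev d), tail_mem_bag (rev d)⟩ : D.bag N) = b) u v := by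
    intro u v
    have key : ∀ v, Relation.ReflTransGen
        (fun a b => ∃ d : D.CDart N, tail d = a ∧ head d = b) (u : V) v →
        ∀ hv : v ∈ D.bag N, Relation.ReflTransGen (fun a b => ∃ d : D.CDart N,
        (⟨tail d, tail_mem_bag d⟩ : D.bag N) = a ∧
          (⟨tail (rev d), tail_mem_bag (rev d)⟩ : D.bag N) = b) u ⟨v, hv⟩ := by
      intro v h
      induction h with
      | refl => exact fun _ => Relation.ReflTransGen.refl
      | tail _ hbc ih =>
        obtain ⟨d, rfl, rfl⟩ := hbc
        exact fun hv => (ih (tail_mem_bag d)).tail ⟨d, rfl, Subtype.ext (tail_rev d)⟩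
    exact key v (E.connected u u.2 v v.2) v.2
  have heuler := E.euler
  rw [Nat.card_eq_fintype_card, Nat.card_eq_fintype_card, ← Nat.card_coe_set_eq,
    Nat.card_eq_fintype_card] at heuler
  -- `O` directs every edge towards its end with the larger number; the ends differ because there
  -- are no loops.
  refine RotationSystem.exists_coboundary_eq (rot := E.rot)
    (tail := fun d => (⟨tail d, tail_mem_bag d⟩ : D.bag N))
    (O := {d | Fintype.equivFin V (tail d) < Fintype.equivFin V (head d)}) rev_involutive ?_
    (fun d => Subtype.ext (E.tail_rot d)) E.face_rot_rev hconn
    (fun φ hφ => eq_of_forall_face_eq hφ) (by convert heuler.ge using 2) hz ?_ E.outer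
  · intro d
    have hne : Fintype.equivFin V (tail d) ≠ Fintype.equivFin V (head d) :=
      fun h => tail_ne_head d ((Fintype.equivFin V).injective h)
    simp only [Set.mem_ofPred_eq, tail_rev, head_rev, not_lt]
    exact ⟨le_of_lt, fun h => lt_of_le_of_ne h (Ne.symm hne)⟩
  · intro v
    refine (Finset.sum_congr rfl fun d _ => ?_).trans (hz' v)
    simp only [Subtype.ext_iff]

open Classical in
/-- Summation by parts: a weight function against the boundary of a set of faces. -/
theorem sum_boundary_mul_weight [Fintype V] [Fintype ι] (A : Finset E.Face) {w : G.Dart → ℤ}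
    (hw : IsSkew w) :
    (∑ d, ((if E.face d ∈ A then 1 else 0) - if E.face (rev d) ∈ A then 1 else 0) *
      weight w d) = 2 * ∑ f ∈ A, E.faceCirculation w f := by
  have h1 : ∑ f ∈ A, E.faceCirculation w f =
      ∑ d, (if E.face d ∈ A then 1 else 0) * weight w d := by
    unfold faceCirculation
    rw [Finset.sum_comm]
    refine Finset.sum_congr rfl fun d _ => ?_
    rw [Finset.sum_ite_eq]
    simp
  have h2 : (∑ d, (if E.face (rev d) ∈ A then 1 else 0) * weight w d) =
      - ∑ d, (if E.face d ∈ A then 1 else 0) * weight w d := by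
    rw [← Equiv.sum_comp (D.revPerm N), ← Finset.sum_neg_distrib]
    refine Finset.sum_congr rfl fun d _ => ?_
    change (if E.face (rev (rev d)) ∈ A then 1 else 0) * weight w (rev d) = _
    rw [rev_rev, weight_rev hw, mul_neg]
  simp_rw [sub_mul]
  rw [Finset.sum_sub_distrib, h2, h1]
  ring

open Classical in
/-- The projection of a cycle on a planar component surrounds a set of inner faces. If the cycle
leaves the component through a virtual edge or triangle, then one of these faces is adjacent to
it. -/
theorem exists_faces_of_isCycleDarts [Fintype V] [Fintype ι] (hQ : IsCycleDarts Q) {d₀ : G.Dart}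
    (hd₀ : d₀ ∈ Q) (hN : D.dartHome d₀ = N) :
    ∃ A : Finset E.Face, ∃ ρ : ℤ, (ρ = 1 ∨ ρ = -1) ∧ E.outer ∉ A ∧
      (∀ w, IsSkew w → (∑ d ∈ Q, if D.dartHome d = N then w d else 0) =
        ρ * ∑ f ∈ A, E.faceCirculation w f) ∧
      ∀ M, D.tree.Adj N M → (∃ d ∈ Q, D.dartHome d ∈ D.side N M) →
        ∃ f ∈ A, E.AdjacentTo f M := by
  have : Fintype E.Face := Fintype.ofFinite _
  obtain ⟨φ, hφ0, hφ⟩ := E.exists_boundary_eq (projectionIndicator_rev (Q := Q) (N := N))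
    (sum_projectionIndicator hQ)
  set A : Finset E.Face := Finset.univ.filter fun f => φ f = 1 with hA
  have hmem : ∀ f, f ∈ A ↔ φ f = 1 := by simp [hA]
  have h2 : ∀ a : ZMod 2, a = 0 ∨ a = 1 := by decide
  have hiff : ∀ d, D.projectionIndicator Q N d = 0 ↔ (E.face d ∈ A ↔ E.face (rev d) ∈ A) := by
    intro d
    rw [hφ d, hmem, hmem]
    rcases h2 (φ (E.face d)) with h | h <;> rcases h2 (φ (E.face (rev d))) with h' | h' <;>
      rw [h, h'] <;> decide
  set a : E.Face → ℤ := fun f => if f ∈ A then 1 else 0 with ha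
  -- The integral boundary of `A`: a conserved flow supported on the edges with exactly one side in
  -- `A`, which are the edges of the projection.
  set Z : D.CDart N → ℤ := fun d => a (E.face d) - a (E.face (rev d)) with hZ
  have hZskew : ∀ d, Z (rev d) = - Z d := by
    intro d
    simp only [hZ, rev_rev]
    ring
  have hZsupp : ∀ d, D.projectionIndicator Q N d = 0 → Z d = 0 := by
    intro d hd
    simp only [hZ, ha, (hiff d).1 hd, sub_self]
  have hZdiv : ∀ v, (∑ d, if tail d = v then Z d else 0) = 0 := fun v =>
    RotationSystem.sum_coboundary (rot := E.rot) rev_involutive E.tail_rot E.face_rot_rev a v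
  obtain ⟨ρ, hρ⟩ := exists_flow_eq hQ hZskew hZdiv hZsupp
  have hρ1 : ρ = 1 ∨ ρ = -1 := by
    rw [← hρ d₀ hd₀ hN]
    have h0 : D.projectionIndicator Q N (.inl ⟨d₀, hN⟩) ≠ 0 := by simp [projectionIndicator, hd₀]
    rw [Ne, hiff] at h0
    simp only [hZ, ha]
    split_ifs with h3 h4 h4
    · exact absurd (iff_of_true h3 h4) h0
    · simp
    · simp
    · exact absurd (iff_of_false h3 h4) h0
  refine ⟨A, ρ, hρ1, ?_, ?_, ?_⟩
  · rw [hmem, hφ0]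
    decide
  · intro w hw
    have h3 := E.sum_boundary_mul_weight A hw
    -- Both `Z` and `w` change sign with the direction, so the two directions of an edge contribute
    -- equally, hence the factor `2`. Virtual edges have weight zero.
    have h4 : (∑ d, ((if E.face d ∈ A then 1 else 0) - if E.face (rev d) ∈ A then 1 else 0) *
        weight w d) = 2 * (ρ * ∑ d ∈ Q, if D.dartHome d = N then w d else 0) := by
      rw [sum_cDart]
      have hvirt : (∑ M, ∑ x, ∑ y,
          if h : D.tree.Adj N M ∧ x ∈ D.sep N M ∧ y ∈ D.sep N M ∧ x ≠ y then
            ((if E.face (.inr ⟨(M, x, y), h⟩) ∈ A then 1 else 0) -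
              if E.face (rev (.inr ⟨(M, x, y), h⟩)) ∈ A then 1 else 0) *
              weight w (.inr ⟨(M, x, y), h⟩ : D.CDart N) else 0) = 0 := by
        simp [weight]
      rw [hvirt, add_zero, sum_dart_eq hQ, Finset.mul_sum, Finset.mul_sum]
      · refine Finset.sum_congr rfl fun d hd => ?_
        by_cases h : D.dartHome d = N
        · have h' : D.dartHome d.symm = N := (D.dartHome_symm d).trans h
          rw [dif_pos h, dif_pos h', if_pos h]
          have e1 : Z (.inl ⟨d, h⟩) = ρ := hρ d hd h
          have e2 : Z (.inl ⟨d.symm, h'⟩) = - ρ := (hZskew (.inl ⟨d, h⟩)).trans (by rw [e1])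
          change Z (.inl ⟨d, h⟩) * w d + Z (.inl ⟨d.symm, h'⟩) * w d.symm = _
          rw [e1, e2, hw d]
          ring
        · have h' : ¬ D.dartHome d.symm = N := fun h' => h ((D.dartHome_symm d).symm.trans h')
          rw [dif_neg h, dif_neg h', if_neg h]
          ring
      · intro d hd hd'
        by_cases h : D.dartHome d = N
        · rw [dif_pos h]
          have : Z (.inl ⟨d, h⟩) = 0 := hZsupp _ (by simp [projectionIndicator, hd, hd'])
          change Z (.inl ⟨d, h⟩) * w d = 0
          rw [this, zero_mul]
        · rw [dif_neg h]
    have h5 : ρ * ρ = 1 := by rcases hρ1 with h | h <;> rw [h] <;> norm_num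
    rw [h4] at h3
    have h6 : ρ * (∑ d ∈ Q, if D.dartHome d = N then w d else 0) =
      ∑ f ∈ A, E.faceCirculation w f := by linarith
    rw [← h6, ← mul_assoc, h5, one_mul]
  · rintro M hM ⟨d, hd, hdM⟩
    obtain ⟨e, he, hez⟩ := exists_projectionIndicator_ne_zero hQ hM hd hd₀ hdM hN
    -- An edge of the projection has exactly one side in `A`, so one of its directions has its face
    -- there.
    obtain ⟨y, hy, hyz, hyA⟩ : ∃ y : D.CDart N, IsVirtualAt M y ∧
        D.projectionIndicator Q N y ≠ 0 ∧ E.face y ∈ A := by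
      by_cases h : E.face e ∈ A
      · exact ⟨e, he, hez, h⟩
      · refine ⟨rev e, isVirtualAt_rev.2 he, by rwa [projectionIndicator_rev], ?_⟩
        by_contra h'
        exact hez ((hiff e).2 (iff_of_false h h'))
    -- If the enclosed face is the virtual triangle itself, it does not count as adjacent. But the
    -- projection uses only one edge of the triangle, so across another edge `x` the set `A`
    -- continues, into a face that is not a triangle.
    by_cases hT : IsTriangleFace E.rot M (E.face y)
    · obtain ⟨x, hx, hxy⟩ := Set.exists_ne_of_one_lt_ncard (by rw [hT.2.1]; norm_num) y
      have hxM : IsVirtualAt M x := hT.2.2 x hx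
      have hx' : E.face x = E.face y := hx
      have hxz : D.projectionIndicator Q N x = 0 := by
        by_contra hxz
        rcases eq_or_eq_rev_of_projectionIndicator hQ hy hxM hyz hxz with h | h
        · exact hxy h
        · exact face_rev_ne hM hT (by rw [← h, hx'])
      refine ⟨E.face (rev x), ((hiff x).1 hxz).1 (hx' ▸ hyA),
        ⟨rev x, isVirtualAt_rev.2 hxM, rfl⟩, ?_⟩
      exact not_isTriangleFace_rev (M := M) (hx' ▸ hT)
    · exact ⟨E.face y, hyA, ⟨y, hy, rfl⟩, hT⟩

end PlanarEmbedding

end ComponentTree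

/-! ### Bounds for the circulation -/

/-- Signed sums of distinct powers of two do not vanish. -/
theorem Finset.abs_sum_two_pow {α : Type*} {s : Finset α} {i : α → ℕ} {r : ℕ}
    (hi : ∀ a ∈ s, ∀ b ∈ s, i a = i b → a = b) (hr : ∀ a ∈ s, i a < r) {c : ℤ} (hc : 0 ≤ c)
    {x : α → ℤ} (hx : ∀ a ∈ s, |x a| = 2 ^ (i a + 1) * c) :
    |∑ a ∈ s, x a| ≤ (2 ^ (r + 1) - 2) * c ∧ (s.Nonempty → 2 * c ≤ |∑ a ∈ s, x a|) := by
  classical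
  have upper : ∀ (t : Finset α) (n : ℕ), t ⊆ s → (∀ a ∈ t, i a < n) →
      |∑ a ∈ t, x a| ≤ (2 ^ (n + 1) - 2) * c := by
    intro t n hts ht
    have h1 : ∑ a ∈ t, 2 ^ i a < 2 ^ n := by
      rw [← Finset.sum_image (f := fun k => 2 ^ k) (g := i)
        (fun a ha b hb h => hi a (hts ha) b (hts hb) h)]
      exact Nat.geomSum_lt le_rfl (by simpa using ht)
    have h2 : (∑ a ∈ t, (2 : ℤ) ^ i a) + 1 ≤ 2 ^ n := by exact_mod_cast h1
    calc |∑ a ∈ t, x a| ≤ ∑ a ∈ t, |x a| := Finset.abs_sum_le_sum_abs _ _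
      _ = (∑ a ∈ t, (2 : ℤ) ^ i a) * (2 * c) := by
        rw [Finset.sum_mul]
        refine Finset.sum_congr rfl fun a ha => ?_
        rw [hx a (hts ha)]
        ring
      _ ≤ (2 ^ n - 1) * (2 * c) := by
        refine mul_le_mul_of_nonneg_right ?_ (by linarith)
        linarith
      _ = (2 ^ (n + 1) - 2) * c := by ring
  refine ⟨upper s r subset_rfl hr, fun hs => ?_⟩
  -- The term with the largest exponent dominates: by `upper` the smaller powers fall short of it by
  -- at least `2 * c`.
  obtain ⟨a, ha, hmax⟩ := s.exists_max_image i hs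
  have h1 := upper (s.erase a) (i a) (s.erase_subset a) fun b hb =>
    lt_of_le_of_ne (hmax b (Finset.mem_of_mem_erase hb)) fun h =>
      Finset.ne_of_mem_erase hb (hi b (Finset.mem_of_mem_erase hb) a ha h)
  rw [← Finset.add_sum_erase s x ha]
  have h2 := abs_sub_abs_le_abs_sub (x a) (-∑ b ∈ s.erase a, x b)
  rw [abs_neg, sub_neg_eq_add, hx a ha] at h2
  linarith

namespace ComponentTree

open SimpleGraph CDart WorkingTree

variable {V ι : Type*} {G : SimpleGraph V} {D : ComponentTree G ι}
  {N M R : ι} {Q : Finset G.Dart} {par : ι → Option ι} {K m : ℕ}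

/-- The bound for the circulation in the subtree with root `N`. -/
noncomputable def subtreeBound [Fintype ι] (par : ι → Option ι) (K : ℕ) (N : ι) : ℤ :=
  (K : ℤ) ^ height par N * (leaves par N : ℤ)

theorem subtreeBound_nonneg [Fintype ι] (N : ι) : 0 ≤ subtreeBound par K N := by
  unfold subtreeBound
  positivity

section

variable [Fintype ι]

open Classical in
-- Double counting: each child contributes once for every face of `A` adjacent to its separating
-- set. Both estimates below bound this number.
theorem sum_targetCirculation (E : D.PlanarEmbedding N) (A : Finset E.Face) :
    ∑ f ∈ A, D.targetCirculation par K E f = ∑ R with par R = some N, 2 * subtreeBound par K R *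
      (A.filter fun f => ∃ M, D.tree.Adj N M ∧ Descends par M R ∧ E.AdjacentTo f M).card := by
  unfold targetCirculation
  rw [Finset.sum_comm, Finset.sum_filter]
  refine Finset.sum_congr rfl fun R _ => ?_
  by_cases hR : par R = some N
  · simp only [hR, true_and, if_true]
    rw [← Finset.sum_filter, Finset.sum_const, nsmul_eq_mul, subtreeBound]
    ring
  · simp [hR]

open Classical in
-- The subtree of a child is on one side of `N`, so it has only one separating set in `N`. At most
-- three faces are adjacent to it, each counting the bound twice.
theorem sum_targetCirculation_le [Finite V] (hc : ∀ N, IsCentered D.tree par N)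
    (E : D.PlanarEmbedding N) (A : Finset E.Face) :
    ∑ f ∈ A, D.targetCirculation par K E f ≤
      6 * ∑ R with par R = some N, subtreeBound par K R := by
  have : Finite (D.CDart N) := finite_cDart
  rw [sum_targetCirculation, Finset.mul_sum]
  refine Finset.sum_le_sum fun R hR => ?_
  have hR' : par R = some N := by simpa using hR
  obtain ⟨M, hM, hMR⟩ := exists_adj_mem_subtree hc hR'
  have h1 : (A.filter fun f => ∃ M, D.tree.Adj N M ∧ Descends par M R ∧ E.AdjacentTo f M).card ≤
      3 := by
    refine le_trans ?_ (E.ncard_adjacentTo_le hM)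
    rw [← Set.ncard_coe_finset]
    refine Set.ncard_le_ncard ?_ (Set.toFinite _)
    intro f hf
    obtain ⟨-, M', hM', hMR', hf⟩ := Finset.mem_filter.1 (Finset.mem_coe.1 hf)
    obtain rfl := JoinedIn.eq_of_adj D.isTree.isAcyclic hM hM'
      (joinedIn_of_mem_subtree hc hR' hMR hMR')
    exact hf
  have h2 : ((A.filter fun f =>
      ∃ M, D.tree.Adj N M ∧ Descends par M R ∧ E.AdjacentTo f M).card : ℤ) ≤ 3 := by
    exact_mod_cast h1
  nlinarith [subtreeBound_nonneg (par := par) (K := K) R]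

open Classical in
theorem le_sum_targetCirculation (E : D.PlanarEmbedding N) (A : Finset E.Face) {P : ι → Prop}
    (hP : ∀ R, par R = some N → P R →
      ∃ f ∈ A, ∃ M, D.tree.Adj N M ∧ Descends par M R ∧ E.AdjacentTo f M) :
    2 * ∑ R with par R = some N ∧ P R, subtreeBound par K R ≤
      ∑ f ∈ A, D.targetCirculation par K E f := by
  rw [sum_targetCirculation, Finset.mul_sum, ← Finset.filter_filter, Finset.sum_filter]
  refine Finset.sum_le_sum fun R hR => ?_
  have hB := subtreeBound_nonneg (par := par) (K := K) R
  split_ifs with h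
  · obtain ⟨f, hf, hf'⟩ := hP R (by simpa using hR) h
    have h1 : 0 < (A.filter fun f =>
        ∃ M, D.tree.Adj N M ∧ Descends par M R ∧ E.AdjacentTo f M).card :=
      Finset.card_pos.2 ⟨f, Finset.mem_filter.2 ⟨hf, hf'⟩⟩
    have h2 : (1 : ℤ) ≤ ((A.filter fun f =>
        ∃ M, D.tree.Adj N M ∧ Descends par M R ∧ E.AdjacentTo f M).card : ℤ) := by
      exact_mod_cast h1
    nlinarith
  · positivity

open Classical in
/-- The part of a sum over the edges of a cycle that belongs to the components of a subtree. -/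
noncomputable def subtreeSum (D : ComponentTree G ι) (par : ι → Option ι) (Q : Finset G.Dart)
    (w : G.Dart → ℤ) (N : ι) : ℤ :=
  ∑ d ∈ Q, if D.dartHome d ∈ subtree par N then w d else 0

open Classical in
theorem subtreeSum_eq (hc : ∀ N, IsCentered D.tree par N) (w : G.Dart → ℤ) (N : ι) :
    D.subtreeSum par Q w N = (∑ d ∈ Q, if D.dartHome d = N then w d else 0) +
      ∑ R with par R = some N, D.subtreeSum par Q w R := by
  unfold subtreeSum
  rw [Finset.sum_comm, ← Finset.sum_add_distrib]
  refine Finset.sum_congr rfl fun d _ => ?_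
  by_cases hN : D.dartHome d = N
  · rw [if_pos (hN ▸ self_mem_subtree), if_pos hN, Finset.sum_eq_zero, add_zero]
    intro R hR
    rw [if_neg]
    rw [hN]
    exact (hc N).notMem R (by simpa using hR)
  · rw [if_neg hN, zero_add]
    by_cases h : D.dartHome d ∈ subtree par N
    · rw [if_pos h]
      obtain ⟨R, hR, hd⟩ := (mem_subtree_iff.1 h).resolve_left hN
      rw [Finset.sum_eq_single_of_mem R (by simpa using hR), if_pos hd]
      intro R' hR' hne
      rw [if_neg]
      exact Set.disjoint_right.1 (disjoint_subtree hc (by simpa using hR') hR hne) hd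
    · rw [if_neg h, Finset.sum_eq_zero]
      intro R hR
      rw [if_neg]
      exact fun h' => h (mem_subtree_iff.2 (.inr ⟨R, by simpa using hR, h'⟩))

open Classical in
/-- The children together have at most the bound of their parent, divided by `K`. -/
theorem sum_subtreeBound_le (hc : ∀ N, IsCentered D.tree par N) (N : ι) :
    ∑ R with par R = some N, subtreeBound par K R ≤
      (K : ℤ) ^ (height par N - 1) * (leaves par N : ℤ) := by
  have h1 : ∑ R with par R = some N, subtreeBound par K R =
      (K : ℤ) ^ (height par N - 1) * ((∑ R with par R = some N, leaves par R : ℕ) : ℤ) := by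
    rw [Nat.cast_sum, Finset.mul_sum]
    refine Finset.sum_congr rfl fun R hR => ?_
    rw [subtreeBound, height_child hc (N := N) (by simpa using hR), Nat.add_sub_cancel]
  rw [h1]
  refine mul_le_mul_of_nonneg_left ?_ (by positivity)
  exact_mod_cast sum_leaves_le hc N

end

variable [Fintype V] [Fintype ι] {emb : ∀ N, Option (D.PlanarEmbedding N)} {w : G.Dart → ℤ}

open Classical in
-- `A` consists of inner faces, so their circulations are the prescribed ones. These being
-- nonnegative, the absolute value only removes the sign `ρ`.
theorem IsWeightZero.planar_sum (hw : D.IsWeightZero par K emb w)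
    (hc : ∀ N, IsCentered D.tree par N) (hQ : IsCycleDarts Q) {E : D.PlanarEmbedding N}
    (hE : emb N = some E) :
    |∑ d ∈ Q, if D.dartHome d = N then w d else 0| ≤
      6 * (∑ R with par R = some N, subtreeBound par K R) ∧
    ((∃ d ∈ Q, D.dartHome d = N) →
      2 * (∑ R with par R = some N ∧ ∃ d ∈ Q, D.dartHome d ∈ subtree par R,
        subtreeBound par K R) ≤ |∑ d ∈ Q, if D.dartHome d = N then w d else 0|) := by
  by_cases h0 : ∃ d ∈ Q, D.dartHome d = N
  · obtain ⟨d₀, hd₀, hN⟩ := h0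
    obtain ⟨A, ρ, hρ, hout, hsum, hadj⟩ := E.exists_faces_of_isCycleDarts hQ hd₀ hN
    have h1 : ∑ f ∈ A, E.faceCirculation w f = ∑ f ∈ A, D.targetCirculation par K E f :=
      Finset.sum_congr rfl fun f hf => hw.planar N E hE f fun h => hout (h ▸ hf)
    have h2 : 0 ≤ ∑ f ∈ A, D.targetCirculation par K E f := by
      rw [sum_targetCirculation]
      refine Finset.sum_nonneg fun R _ => ?_
      have := subtreeBound_nonneg (par := par) (K := K) R
      positivity
    have h3 : |∑ d ∈ Q, if D.dartHome d = N then w d else 0| =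
        ∑ f ∈ A, D.targetCirculation par K E f := by
      rw [hsum w hw.skew, h1, abs_mul, abs_of_nonneg h2]
      rcases hρ with h | h <;> simp [h]
    have h4 : ∀ R, par R = some N → (∃ d ∈ Q, D.dartHome d ∈ subtree par R) →
        ∃ f ∈ A, ∃ M, D.tree.Adj N M ∧ Descends par M R ∧ E.AdjacentTo f M := by
      rintro R hR ⟨d, hd, hdR⟩
      obtain ⟨M, hM, hMR⟩ := exists_adj_mem_subtree hc hR
      obtain ⟨f, hf, hfM⟩ := hadj M hM ⟨d, hd, joinedIn_of_mem_subtree hc hR hMR hdR⟩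
      exact ⟨f, hf, M, hM, hMR, hfM⟩
    have h5 := le_sum_targetCirculation (K := K) E A h4
    rw [h3]
    refine ⟨sum_targetCirculation_le hc E A, fun _ => ?_⟩
    convert h5
  · refine ⟨?_, fun h => absurd h h0⟩
    rw [Finset.sum_eq_zero fun d hd => if_neg fun h => h0 ⟨d, hd, h⟩, abs_zero]
    exact mul_nonneg (by norm_num) (Finset.sum_nonneg fun R _ => subtreeBound_nonneg R)

open Classical in
-- The weights on the cycle are, up to sign, distinct powers of two times a common factor, so
-- `Finset.abs_sum_two_pow` applies.
theorem IsWeightZero.const_sum (hw : D.IsWeightZero par K emb w) (hQ : IsCycleDarts Q)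
    (hE : emb N = none) (hm : Nat.card (D.RealEdge N) ≤ m) :
    |∑ d ∈ Q, if D.dartHome d = N then w d else 0| ≤
      (2 ^ (m + 1) - 2) * ((K : ℤ) ^ (height par N - 1) * (leaves par N : ℤ)) ∧
    ((∃ d ∈ Q, D.dartHome d = N) →
      2 * ((K : ℤ) ^ (height par N - 1) * (leaves par N : ℤ)) ≤
        |∑ d ∈ Q, if D.dartHome d = N then w d else 0|) := by
  obtain ⟨idx, hidx⟩ := hw.const N hE
  set i : G.Dart → ℕ := fun d =>
    if h : D.dartHome d = N then (idx ⟨⟨d.edge, d.edge_mem⟩, h⟩ : ℕ) else 0 with hi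
  rw [← Finset.sum_filter]
  have key := Finset.abs_sum_two_pow (s := Q.filter fun d => D.dartHome d = N) (i := i) (r := m)
    (c := (K : ℤ) ^ (height par N - 1) * (leaves par N : ℤ)) (x := w) ?_ ?_ (by positivity) ?_
  · refine ⟨key.1, fun ⟨d, hd, hN⟩ => key.2 ⟨d, Finset.mem_filter.2 ⟨hd, hN⟩⟩⟩
  · intro a ha b hb hab
    obtain ⟨ha, haN⟩ := Finset.mem_filter.1 ha
    obtain ⟨hb, hbN⟩ := Finset.mem_filter.1 hb
    simp only [hi, dif_pos haN, dif_pos hbN] at hab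
    -- The two directions of an edge share an index, but a cycle uses only one of them.
    have h1 := idx.injective (Fin.ext hab)
    have h2 : a.edge = b.edge := congrArg (fun e => (e.1 : Sym2 V)) h1
    rcases dart_edge_eq_iff a b |>.1 h2 with h | h
    · exact h
    · exact absurd (h ▸ ha) (hQ.symm_notMem b hb)
  · intro a ha
    obtain ⟨ha, haN⟩ := Finset.mem_filter.1 ha
    simp only [hi, dif_pos haN]
    exact (Fin.is_lt _).trans_le hm
  · intro a ha
    obtain ⟨ha, haN⟩ := Finset.mem_filter.1 ha
    simp only [hi, dif_pos haN]
    rw [hidx a haN, mul_assoc]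

/-- With `c` the bound of `N` divided by `K`, the children contribute at most `c` in total, and `N`
itself at most `6c` if planar and `(2^(m+1) - 2)c` if constant sized. Either way the total is below
`K * c`. -/
theorem abs_subtreeSum_lt (hw : D.IsWeightZero par K emb w) (hc : ∀ N, IsCentered D.tree par N)
    (hm : ∀ N, emb N = none → Nat.card (D.RealEdge N) ≤ m) (hK : max (2 ^ (m + 2)) 7 < K)
    (hQ : IsCycleDarts Q) (N : ι) : |D.subtreeSum par Q w N| < subtreeBound par K N := by
  classical
  induction N using induction_on_children hc with
  | h N ih =>
    rw [subtreeSum_eq hc]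
    set c := (K : ℤ) ^ (height par N - 1) * (leaves par N : ℤ) with hcdef
    have hK7 : (7 : ℤ) < K := by exact_mod_cast (le_max_right _ _).trans_lt hK
    have hKm : (2 : ℤ) ^ (m + 2) < K := by exact_mod_cast (le_max_left _ _).trans_lt hK
    have hB : subtreeBound par K N = K * c := by
      rw [subtreeBound, hcdef, ← mul_assoc, ← pow_succ',
        Nat.sub_add_cancel (height_pos (par := par) N)]
    have hcpos : 0 < c := by
      have h1 : (0 : ℤ) < leaves par N := by exact_mod_cast leaves_pos hc N
      have h2 : (0 : ℤ) < K := by linarith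
      positivity
    have hchild : |∑ R with par R = some N, D.subtreeSum par Q w R| ≤
        ∑ R with par R = some N, subtreeBound par K R :=
      (Finset.abs_sum_le_sum_abs _ _).trans
        (Finset.sum_le_sum fun R hR => (ih R (by simpa using hR)).le)
    have hsum : ∑ R with par R = some N, subtreeBound par K R ≤ c := sum_subtreeBound_le hc N
    have habs := abs_add_le (∑ d ∈ Q, if D.dartHome d = N then w d else 0)
      (∑ R with par R = some N, D.subtreeSum par Q w R)
    rw [hB]
    cases hE : emb N with
    | some E =>
      have h1 := (hw.planar_sum hc hQ hE).1
      nlinarith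
    | none =>
      have h1 := (hw.const_sum hQ hE (hm N hE)).1
      have h2 : (2 : ℤ) ^ (m + 2) = 2 * 2 ^ (m + 1) := by ring
      have h3 : (0 : ℤ) < 2 ^ (m + 1) := by positivity
      nlinarith

/-- A cycle that meets at least two components has nonzero circulation. -/
theorem IsWeightZero.sum_ne_zero (hw : D.IsWeightZero par K emb w)
    (hpar : IsWorkingTree D.tree par)
    (hm : ∀ N, emb N = none → Nat.card (D.RealEdge N) ≤ m) (hK : max (2 ^ (m + 2)) 7 < K)
    (hQ : IsCycleDarts Q) {d d' : G.Dart} (hd : d ∈ Q) (hd' : d' ∈ Q)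
    (hne : D.dartHome d ≠ D.dartHome d') : ∑ d ∈ Q, w d ≠ 0 := by
  classical
  have hc := hpar.isCentered D.isTree
  obtain ⟨N, ⟨d₀, hd₀, hN⟩, hsub⟩ := hpar.exists_top D.isTree
    (Q := {N | ∃ d ∈ Q, D.dartHome d = N}) ⟨_, d, hd, rfl⟩ (by
      rintro c hcQ _ ⟨a, ha, rfl⟩ _ ⟨b, hb, rfl⟩
      exact joinedIn_of_isCycleDarts hQ (fun e he h => hcQ ⟨e, he, h⟩) ha hb)
  have htop : ∀ e ∈ Q, D.dartHome e ∈ subtree par N := fun e he => hsub ⟨e, he, rfl⟩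
  have h1 : ∑ d ∈ Q, w d = D.subtreeSum par Q w N :=
    Finset.sum_congr rfl fun e he => (if_pos (htop e he)).symm
  obtain ⟨R₀, hR₀, e₀, he₀, hR₀'⟩ : ∃ R, par R = some N ∧
      ∃ e ∈ Q, D.dartHome e ∈ subtree par R := by
    obtain ⟨e, he, heN⟩ : ∃ e ∈ Q, D.dartHome e ≠ N := by
      by_cases h : D.dartHome d = N
      · exact ⟨d', hd', fun h' => hne (h.trans h'.symm)⟩
      · exact ⟨d, hd, h⟩
    obtain ⟨R, hR, heR⟩ := (mem_subtree_iff.1 (htop e he)).resolve_left heN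
    exact ⟨R, hR, e, he, heR⟩
  -- Only the children whose subtree the cycle meets contribute. There is at least one, which makes
  -- the estimate strict.
  have h2 : |∑ R with par R = some N, D.subtreeSum par Q w R| <
      ∑ R with par R = some N ∧ ∃ d ∈ Q, D.dartHome d ∈ subtree par R, subtreeBound par K R := by
    have h3 : ∑ R with par R = some N, D.subtreeSum par Q w R =
        ∑ R with par R = some N ∧ ∃ d ∈ Q, D.dartHome d ∈ subtree par R,
          D.subtreeSum par Q w R := by
      rw [← Finset.filter_filter]
      refine (Finset.sum_filter_of_ne fun R _ h => ?_).symm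
      by_contra h'
      exact h (Finset.sum_eq_zero fun e he => if_neg fun h'' => h' ⟨e, he, h''⟩)
    rw [h3]
    refine (Finset.abs_sum_le_sum_abs _ _).trans_lt (Finset.sum_lt_sum_of_nonempty ?_ fun R _ =>
      abs_subtreeSum_lt hw hc hm hK hQ R)
    exact ⟨R₀, Finset.mem_filter.2 ⟨Finset.mem_univ _, hR₀, e₀, he₀, hR₀'⟩⟩
  have h4 : 0 ≤ ∑ R with par R = some N ∧ ∃ d ∈ Q, D.dartHome d ∈ subtree par R,
      subtreeBound par K R := Finset.sum_nonneg fun R _ => subtreeBound_nonneg R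
  rw [h1, subtreeSum_eq hc]
  -- By `h2` the left side is positive, so it is less than its double. The planar estimate gives
  -- this double directly; in a constant sized component the lower bound `2c` suffices, because the
  -- left side is at most `c`.
  have h5 : ∑ R with par R = some N ∧ ∃ d ∈ Q, D.dartHome d ∈ subtree par R,
      subtreeBound par K R < |∑ d ∈ Q, if D.dartHome d = N then w d else 0| := by
    cases hE : emb N with
    | some E =>
      have h6 := (hw.planar_sum hc hQ hE).2 ⟨d₀, hd₀, hN⟩
      have h7 := (abs_nonneg _).trans_lt h2
      linarith
    | none =>
      have h6 := (hw.const_sum hQ hE (hm N hE)).2 ⟨d₀, hd₀, hN⟩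
      have h7 := (abs_nonneg _).trans_lt h2
      have h8 := sum_subtreeBound_le (K := K) hc N
      have h9 : ∑ R with par R = some N ∧ ∃ d ∈ Q, D.dartHome d ∈ subtree par R,
          subtreeBound par K R ≤ ∑ R with par R = some N, subtreeBound par K R := by
        rw [← Finset.filter_filter]
        exact Finset.sum_le_sum_of_subset_of_nonneg (Finset.filter_subset _ _)
          fun R _ _ => subtreeBound_nonneg R
      linarith
  intro h0
  rw [add_eq_zero_iff_eq_neg] at h0
  rw [h0, abs_neg] at h5
  linarith

end ComponentTree

/-! ### Existence of the weight function -/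

namespace ComponentTree

open SimpleGraph CDart WorkingTree

variable {V ι : Type*} {G : SimpleGraph V} {D : ComponentTree G ι} {N M M' : ι}

/-- The separating sets of `N` are disjoint, so virtual cliques of different neighbours share no
vertex. -/
theorem isVirtualAt_of_mem_sep {d e : D.CDart N} (hd : IsVirtualAt M d) (he : IsVirtualAt M' e)
    (h : tail e = tail d) : IsVirtualAt M e := by
  obtain rfl := eq_of_mem_sep hd.adj he.adj hd.tail_mem (h ▸ he.tail_mem)
  exact he

namespace PlanarEmbedding

variable {E : D.PlanarEmbedding N}

section

variable [Fintype V] [Fintype ι] {Z : D.CDart N → ℤ}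

open Classical in
/-- A flow on the virtual edges vanishes on the virtual edge of a separating pair. -/
theorem flow_eq_zero_of_pair (hdiv : ∀ v, (∑ d, if tail d = v then Z d else 0) = 0)
    (hreal : ∀ d, Z (.inl d) = 0) {d : D.CDart N} (hd : IsVirtualAt M d)
    (h2 : (D.sep N M).ncard = 2) : Z d = 0 := by
  have h := hdiv (tail d)
  -- A separating pair has only one virtual edge leaving each of its vertices; conservation there
  -- leaves `Z d` alone.
  rw [Finset.sum_eq_single d, if_pos rfl] at h
  · exact h
  · intro e _ hed
    split_ifs with ht
    · rcases e with e | e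
      · exact hreal e
      · have he : IsVirtualAt M (.inr e : D.CDart N) :=
          isVirtualAt_of_mem_sep hd (M' := e.1.1) rfl ht
        exfalso
        refine hed (he.ext hd ht ?_)
        by_contra hh
        have hsub : ({tail d, head d, head (.inr e : D.CDart N)} : Set V) ⊆ D.sep N M := by
          rintro x (rfl | rfl | rfl)
          exacts [hd.tail_mem, hd.head_mem, he.head_mem]
        have h3 : ({tail d, head d, head (.inr e : D.CDart N)} : Set V).ncard = 3 :=
          Set.ncard_eq_three.2 ⟨_, _, _, tail_ne_head d,
            ht ▸ tail_ne_head (.inr e : D.CDart N), Ne.symm hh, rfl⟩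
        have := Set.ncard_le_ncard hsub (Set.toFinite _)
        omega
    · rfl
  · simp

open Classical in
/-- A flow on the virtual edges is preserved at each vertex of a separating triplet. -/
theorem flow_add_eq_zero_of_triple (hdiv : ∀ v, (∑ d, if tail d = v then Z d else 0) = 0)
    (hreal : ∀ d, Z (.inl d) = 0) {d d' : D.CDart N} (hd : IsVirtualAt M d)
    (hd' : IsVirtualAt M d') (ht' : tail d' = tail d) (hne : d ≠ d')
    (h3 : (D.sep N M).ncard = 3) : Z d + Z d' = 0 := by
  have h := hdiv (tail d)
  rw [Fintype.sum_eq_add d d' hne, if_pos rfl, if_pos ht'] at h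
  · exact h
  · rintro e ⟨hed, hed'⟩
    split_ifs with ht
    · rcases e with e | e
      · exact hreal e
      · have he : IsVirtualAt M (.inr e : D.CDart N) :=
          isVirtualAt_of_mem_sep hd (M' := e.1.1) rfl ht
        exfalso
        have hh : head (.inr e : D.CDart N) ≠ head d := fun hh => hed (he.ext hd ht hh)
        have hh' : head (.inr e : D.CDart N) ≠ head d' :=
          fun hh => hed' (he.ext hd' (ht.trans ht'.symm) hh)
        have hh'' : head d ≠ head d' := fun hh => hne (hd.ext hd' ht'.symm hh)
        have hsub : ({tail d, head d, head d', head (.inr e : D.CDart N)} : Set V) ⊆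
            D.sep N M := by
          rintro x (rfl | rfl | rfl | rfl)
          exacts [hd.tail_mem, hd.head_mem, hd'.head_mem, he.head_mem]
        have h4 : ({tail d, head d, head d', head (.inr e : D.CDart N)} : Set V).ncard = 4 := by
          rw [Set.ncard_insert_of_notMem, Set.ncard_eq_three.2
            ⟨_, _, _, hh'', Ne.symm hh, Ne.symm hh', rfl⟩]
          rintro (h | h | h)
          · exact tail_ne_head d h
          · exact tail_ne_head d' (ht'.trans h)
          · exact tail_ne_head (.inr e : D.CDart N) (ht.trans h)
        have := Set.ncard_le_ncard hsub (Set.toFinite _)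
        omega
    · rfl

open Classical in
/-- Every face except the virtual triangles can be reached from the outer face by crossing real
edges. -/
theorem reflTransGen_outer (E : D.PlanarEmbedding N) {f : E.Face}
    (hf : ∀ M, ¬ IsTriangleFace E.rot M f) :
    Relation.ReflTransGen (fun f g => ∃ d : D.RealDart N,
      E.face (.inl d) = f ∧ E.face (rev (.inl d)) = g) E.outer f := by
  set r : E.Face → E.Face → Prop := fun f g => ∃ d : D.RealDart N,
    E.face (.inl d) = f ∧ E.face (rev (.inl d)) = g with hr
  -- `a` indicates the reachable faces. It agrees on the two sides of every real edge, so its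
  -- coboundary `Z` is a flow on the virtual edges.
  set a : E.Face → ℤ := fun f => if Relation.ReflTransGen r E.outer f then 1 else 0 with ha
  set Z : D.CDart N → ℤ := fun d => a (E.face d) - a (E.face (rev d)) with hZ
  have hreal : ∀ d, Z (.inl d) = 0 := by
    intro d
    have h : Relation.ReflTransGen r E.outer (E.face (.inl d)) ↔
        Relation.ReflTransGen r E.outer (E.face (rev (.inl d))) :=
      ⟨fun h => h.tail ⟨d, rfl, rfl⟩, fun h => h.tail ⟨_, rfl, by
        change E.face (rev (rev (.inl d))) = _
        rw [rev_rev]⟩⟩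
    simp only [hZ, ha, h, sub_self]
  have hdiv : ∀ v, (∑ d, if tail d = v then Z d else 0) = 0 := fun v =>
    RotationSystem.sum_coboundary (rot := E.rot) rev_involutive E.tail_rot E.face_rot_rev a v
  -- the value of `a` on a triangle face is replaced by the one across the edge
  set ψ : D.CDart N → ℤ := fun d =>
    if ∃ M, IsTriangleFace E.rot M (E.face d) then a (E.face (rev d)) else a (E.face d) with hψ
  have hψrev : ∀ d, ψ (rev d) = ψ d := by
    intro d
    by_cases h1 : ∃ M, IsTriangleFace E.rot M (E.face d)
    · have h2 : ¬ ∃ M, IsTriangleFace E.rot M (E.face (rev d)) := by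
        rintro ⟨M', h2⟩
        obtain ⟨M, h1⟩ := h1
        exact not_isTriangleFace_rev h1 h2
      simp only [hψ, if_pos h1, if_neg h2]
    · by_cases h2 : ∃ M, IsTriangleFace E.rot M (E.face (rev d))
      · simp only [hψ, if_pos h2, if_neg h1, rev_rev]
      · simp only [hψ, if_neg h1, if_neg h2]
        have hZd : Z d = 0 := by
          rcases d with d | x
          · exact hreal d
          · have hx : IsVirtualAt x.1.1 (.inr x : D.CDart N) := rfl
            rcases D.sep_card N _ hx.adj with h3 | h3
            · exact flow_eq_zero_of_pair hdiv hreal hx h3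
            · obtain ⟨T, hT⟩ := E.triangle_face _ hx.adj h3
              rcases face_eq_or_face_rev_eq hT hx with h | h
              · exact absurd ⟨_, h ▸ hT⟩ h1
              · exact absurd ⟨_, h ▸ hT⟩ h2
        exact (sub_eq_zero.1 hZd).symm
  -- If the face between `d` and `E.rot d` is a triangle, these are its two edges at the vertex. In
  -- the conservation law for `Z` the value of `a` on the triangle cancels, leaving equal values
  -- across the two edges.
  have hψrot : ∀ d, ψ (E.rot d) = ψ d := by
    intro d
    rw [← hψrev d]
    by_cases h1 : ∃ M, IsTriangleFace E.rot M (E.face (rev d))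
    · simp only [hψ, E.face_rot, if_pos h1, rev_rev]
      obtain ⟨M, h1⟩ := h1
      have hd : IsVirtualAt M (rev d) := h1.2.2 _ rfl
      have hd' : IsVirtualAt M (E.rot d) := h1.2.2 _ (E.face_rot d)
      have hne : d ≠ E.rot d := by
        intro h
        apply face_rev_ne hd.adj h1
        rw [rev_rev]
        nth_rw 1 [h]
        exact E.face_rot d
      have h4 := flow_add_eq_zero_of_triple hdiv hreal (isVirtualAt_rev.1 hd) hd' (E.tail_rot d)
        hne h1.1
      simp only [hZ, E.face_rot] at h4
      linarith
    · simp only [hψ, E.face_rot, if_neg h1]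
  obtain ⟨d, hd⟩ := E.exists_face_eq E.outer
  obtain ⟨e, rfl⟩ := E.exists_face_eq f
  have hψd : ψ d = 1 := by
    have h1 : ¬ ∃ M, IsTriangleFace E.rot M (E.face d) := by
      rintro ⟨M, h1⟩
      exact E.outer_not_triangle M (h1.2.2 d rfl).adj (hd ▸ h1)
    simp only [hψ, if_neg h1, ha, hd]
    exact if_pos Relation.ReflTransGen.refl
  have hψe : ψ e = 1 := dart_induction (E := E) (P := fun e => ψ e = 1)
    (fun d h => (hψrev d).trans h) (fun d h => (hψrot d).trans h) hψd e
  have h1 : ¬ ∃ M, IsTriangleFace E.rot M (E.face e) := fun ⟨M, h⟩ => hf M h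
  simp only [hψ, if_neg h1, ha] at hψe
  by_contra h
  rw [if_neg h] at hψe
  exact zero_ne_one hψe

open Classical in
theorem faceCirculation_add (w w' : G.Dart → ℤ) (f : E.Face) :
    E.faceCirculation (w + w') f = E.faceCirculation w f + E.faceCirculation w' f := by
  unfold faceCirculation
  rw [← Finset.sum_add_distrib]
  refine Finset.sum_congr rfl fun d _ => ?_
  split_ifs
  · rcases d with d | x
    · rfl
    · simp [weight]
  · simp

open Classical in
theorem faceCirculation_smul (c : ℤ) (w : G.Dart → ℤ) (f : E.Face) :
    E.faceCirculation (c • w) f = c * E.faceCirculation w f := by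
  unfold faceCirculation
  rw [Finset.mul_sum]
  refine Finset.sum_congr rfl fun d _ => ?_
  split_ifs
  · rcases d with d | x
    · rfl
    · simp [weight]
  · simp

theorem faceCirculation_zero (f : E.Face) : E.faceCirculation 0 f = 0 := by
  simpa using faceCirculation_smul (E := E) 0 0 f

theorem faceCirculation_sum {α : Type*} (s : Finset α) (w : α → G.Dart → ℤ) (f : E.Face) :
    E.faceCirculation (∑ i ∈ s, w i) f = ∑ i ∈ s, E.faceCirculation (w i) f := by
  classical
  induction s using Finset.induction_on with
  | empty => simp [faceCirculation_zero]
  | insert a s ha ih => rw [Finset.sum_insert ha, Finset.sum_insert ha, faceCirculation_add, ih]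

open Classical in
-- A unit weight on the reverse of `d` raises the circulation of the face to the right of that
-- reverse and lowers the one to the right of `d`.
theorem exists_faceCirculation_edge (E : D.PlanarEmbedding N) (d : D.RealDart N) :
    ∃ w : G.Dart → ℤ, IsSkew w ∧ ∀ f : E.Face, E.faceCirculation w f =
      (if E.face (rev (.inl d)) = f then 1 else 0) - if E.face (.inl d) = f then 1 else 0 := by
  refine ⟨fun e => (if e = d.1.symm then 1 else 0) - if e = d.1 then 1 else 0, ?_, ?_⟩
  · intro e
    have h1 : e.symm = d.1.symm ↔ e = d.1 := Dart.symm_involutive.injective.eq_iff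
    have h2 : e.symm = d.1 ↔ e = d.1.symm := Dart.symm_involutive.eq_iff
    simp only [h1, h2]
    ring
  · intro f
    have hd' : D.dartHome d.1.symm = N := (D.dartHome_symm d.1).trans d.2
    unfold faceCirculation
    rw [Fintype.sum_eq_add (.inl ⟨d.1.symm, hd'⟩) (.inl d)]
    · have h1 : d.1.symm ≠ d.1 := d.1.symm_ne
      have h2 : (rev (.inl d) : D.CDart N) = .inl ⟨d.1.symm, hd'⟩ := rfl
      rw [h2]
      simp only [weight, if_true, if_neg h1, if_neg h1.symm]
      split_ifs <;> norm_num
    · intro h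
      exact d.1.symm_ne (congrArg Subtype.val (Sum.inl_injective h))
    · rintro (e | x) ⟨h1, h2⟩
      · have h3 : e.1 ≠ d.1.symm := fun h => h1 (congrArg Sum.inl (Subtype.ext h))
        have h4 : e.1 ≠ d.1 := fun h => h2 (congrArg Sum.inl (Subtype.ext h))
        simp [weight, h3, h4]
      · simp [weight]

open Classical in
/-- A unit of circulation can be moved from the outer face to any face that is not a virtual
triangle. -/
theorem exists_faceCirculation_single (E : D.PlanarEmbedding N) {f : E.Face}
    (hf : ∀ M, ¬ IsTriangleFace E.rot M f) :
    ∃ w : G.Dart → ℤ, IsSkew w ∧ ∀ g : E.Face, E.faceCirculation w g =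
      (if f = g then 1 else 0) - if E.outer = g then 1 else 0 := by
  have h := E.reflTransGen_outer hf
  clear hf
  induction h with
  | refl =>
    refine ⟨0, fun _ => by simp, fun g => ?_⟩
    rw [faceCirculation_zero, sub_self]
  | tail _ hbc ih =>
    obtain ⟨w, hw, hw'⟩ := ih
    obtain ⟨d, rfl, rfl⟩ := hbc
    obtain ⟨w₁, hw₁, hw₁'⟩ := E.exists_faceCirculation_edge d
    refine ⟨w + w₁, fun e => ?_, fun g => ?_⟩
    · simp only [Pi.add_apply, hw e, hw₁ e]
      ring
    · rw [faceCirculation_add, hw', hw₁']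
      ring

/-- Arbitrary circulations can be prescribed on the inner faces that are not virtual triangles. -/
theorem exists_faceCirculation_eq (E : D.PlanarEmbedding N) (t : E.Face → ℤ)
    (ht : ∀ f M, IsTriangleFace E.rot M f → t f = 0) :
    ∃ w : G.Dart → ℤ, IsSkew w ∧ ∀ f ≠ E.outer, E.faceCirculation w f = t f := by
  classical
  have : Finite (D.CDart N) := finite_cDart
  have : Fintype E.Face := Fintype.ofFinite _
  -- For a virtual triangle no such `w` is needed, as its coefficient `t f` vanishes; hence the
  -- guard `t f ≠ 0`.
  have h : ∀ f : E.Face, ∃ w : G.Dart → ℤ, IsSkew w ∧ ∀ g : E.Face, t f ≠ 0 →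
      E.faceCirculation w g = (if f = g then 1 else 0) - if E.outer = g then 1 else 0 := by
    intro f
    by_cases hf : ∃ M, IsTriangleFace E.rot M f
    · obtain ⟨M, hM⟩ := hf
      exact ⟨0, fun _ => by simp, fun g h => absurd (ht f M hM) h⟩
    · obtain ⟨w, hw, hw'⟩ := E.exists_faceCirculation_single fun M hM => hf ⟨M, hM⟩
      exact ⟨w, hw, fun g _ => hw' g⟩
  choose w hw hw' using h
  -- All the compensating circulation collects on the outer face, where nothing is prescribed.
  refine ⟨∑ f, t f • w f, fun d => ?_, fun g hg => ?_⟩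
  · simp only [Finset.sum_apply, Pi.smul_apply, hw _ d, smul_neg, Finset.sum_neg_distrib]
  · rw [faceCirculation_sum, Finset.sum_eq_single g]
    · rw [faceCirculation_smul]
      by_cases h0 : t g = 0
      · rw [h0, zero_mul]
      · rw [hw' g g h0, if_pos rfl, if_neg (Ne.symm hg)]
        ring
    · intro f _ hfg
      rw [faceCirculation_smul]
      by_cases h0 : t f = 0
      · rw [h0, zero_mul]
      · rw [hw' f g h0, if_neg hfg, if_neg (Ne.symm hg)]
        ring
    · simp

theorem faceCirculation_congr {w w' : G.Dart → ℤ} (h : ∀ d, D.dartHome d = N → w d = w' d)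
    (f : E.Face) : E.faceCirculation w f = E.faceCirculation w' f := by
  unfold faceCirculation
  refine Finset.sum_congr rfl fun d _ => ?_
  rcases d with d | x
  · simp only [weight, h d.1 d.2]
  · rfl

end

theorem targetCirculation_eq_zero [Fintype ι] {par : ι → Option ι} {K : ℕ} {f : E.Face}
    (hf : IsTriangleFace E.rot M f) : D.targetCirculation par K E f = 0 := by
  unfold targetCirculation
  refine Finset.sum_eq_zero fun R _ => if_neg ?_
  rintro ⟨-, M', -, -, ⟨d, hd, hdf⟩, hnot⟩
  obtain rfl : M = M' := IsTriangleFace.eq hf hdf hd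
  exact hnot hf

theorem targetCirculation_eq_zero_of_leaf [Fintype ι] {par : ι → Option ι} {K : ℕ} {f : E.Face}
    (hN : ∀ R, par R ≠ some N) : D.targetCirculation par K E f = 0 := by
  unfold targetCirculation
  exact Finset.sum_eq_zero fun R _ => if_neg fun h => hN R h.1

end PlanarEmbedding

open Classical in
/-- Skew-symmetric weights with prescribed absolute values. -/
theorem exists_isSkew_abs [Finite V] (c : G.edgeSet → ℤ) (hc : ∀ e, 0 ≤ c e) :
    ∃ w : G.Dart → ℤ, IsSkew w ∧ ∀ d, |w d| = c ⟨d.edge, d.edge_mem⟩ := by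
  have := Fintype.ofFinite V
  refine ⟨fun d => (if Fintype.equivFin V d.fst < Fintype.equivFin V d.snd then 1 else -1) *
    c ⟨d.edge, d.edge_mem⟩, fun d => ?_, fun d => ?_⟩
  · have h1 : c ⟨d.symm.edge, d.symm.edge_mem⟩ = c ⟨d.edge, d.edge_mem⟩ :=
      congrArg c (Subtype.ext d.edge_symm)
    have h2 : Fintype.equivFin V d.fst ≠ Fintype.equivFin V d.snd :=
      fun h => d.adj.ne ((Fintype.equivFin V).injective h)
    change (if Fintype.equivFin V d.snd < Fintype.equivFin V d.fst then (1 : ℤ) else -1) *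
      c ⟨d.symm.edge, d.symm.edge_mem⟩ = _
    rw [h1]
    rcases lt_or_gt_of_ne h2 with h | h
    · simp [h, h.not_gt]
    · simp [h, h.not_gt]
  · rw [abs_mul, abs_of_nonneg (hc _)]
    split_ifs <;> simp

/-- The conditions for different components concern disjoint sets of edges. Each component is
treated separately, and an edge takes its weight from its own component. -/
theorem exists_isWeightZero [Fintype V] [Fintype ι] (par : ι → Option ι) (K : ℕ)
    (emb : ∀ N, Option (D.PlanarEmbedding N)) : ∃ w : G.Dart → ℤ, D.IsWeightZero par K emb w := by
  classical
  have h : ∀ N, ∃ w : G.Dart → ℤ, IsSkew w ∧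
      (∀ E, emb N = some E → ∀ f : E.Face, f ≠ E.outer →
        E.faceCirculation w f = D.targetCirculation par K E f) ∧
      (emb N ≠ none → (∀ R, par R ≠ some N) → ∀ d, D.dartHome d = N → w d = 0) ∧
      (emb N = none → ∃ idx : D.RealEdge N ≃ Fin (Nat.card (D.RealEdge N)),
        ∀ (d : G.Dart) (hd : D.dartHome d = N),
          |w d| = 2 ^ ((idx ⟨⟨d.edge, d.edge_mem⟩, hd⟩ : ℕ) + 1) *
            (K : ℤ) ^ (WorkingTree.height par N - 1) * (WorkingTree.leaves par N : ℤ)) := by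
    intro N
    cases hE : emb N with
    | some E =>
      by_cases hN : ∀ R, par R ≠ some N
      · refine ⟨0, fun _ => by simp, fun E' hE' f hf => ?_, fun _ _ _ _ => rfl, by simp⟩
        rw [PlanarEmbedding.faceCirculation_zero,
          PlanarEmbedding.targetCirculation_eq_zero_of_leaf hN]
      · obtain ⟨w, hw, hw'⟩ := E.exists_faceCirculation_eq (D.targetCirculation par K E)
          fun f M hf => PlanarEmbedding.targetCirculation_eq_zero hf
        refine ⟨w, hw, fun E' hE' f hf => ?_, fun _ h => absurd h hN, by simp⟩
        obtain rfl : E = E' := by simpa using hE'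
        exact hw' f hf
    | none =>
      have : Finite G.Dart := finite_dart
      have idx : D.RealEdge N ≃ Fin (Nat.card (D.RealEdge N)) := Finite.equivFin _
      obtain ⟨w, hw, hw'⟩ := exists_isSkew_abs (G := G) (fun e => if h : D.home e = N then
        2 ^ ((idx ⟨e, h⟩ : ℕ) + 1) * (K : ℤ) ^ (WorkingTree.height par N - 1) *
          (WorkingTree.leaves par N : ℤ) else 0) (fun e => by split_ifs <;> positivity)
      refine ⟨w, hw, by simp, by simp, fun _ => ⟨idx, fun d hd => ?_⟩⟩
      rw [hw']
      exact dif_pos hd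
  choose w hskew hplanar hleaf hconst using h
  refine ⟨fun d => w (D.dartHome d) d, fun d => ?_, fun N E hE f hf => ?_, ?_, fun N hN => ?_⟩
  · rw [dartHome_symm]
    exact hskew _ d
  · rw [← hplanar N E hE f hf]
    exact PlanarEmbedding.faceCirculation_congr (fun d hd => by rw [hd]) f
  · rintro _ hN hR d rfl
    exact hleaf _ hN hR d rfl
  · obtain ⟨idx, hidx⟩ := hconst N hN
    refine ⟨idx, ?_⟩
    rintro d rfl
    exact hidx d rfl

end ComponentTree

theorem mainTheorem4 {V ι : Type*} [Fintype V] [Fintype ι] (G : SimpleGraph V)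
    (D : ComponentTree G ι)
    (emb : ∀ N, Option (D.PlanarEmbedding N))
    (m : ℕ) (hm : ∀ N, emb N = none → Nat.card (D.RealEdge N) ≤ m)
    (K : ℕ) (hK : max (2 ^ (m + 2)) 7 < K)
    (par : ι → Option ι) (hpar : WorkingTree.IsWorkingTree D.tree par) :
    (∃ w : G.Dart → ℤ, D.IsWeightZero par K emb w) ∧
    ∀ w : G.Dart → ℤ, D.IsWeightZero par K emb w →
      ∀ (u : V) (C : G.Walk u u), C.IsCycle →
        (∃ N M, N ≠ M ∧ D.projection C N ≠ [] ∧ D.projection C M ≠ []) →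
        ComponentTree.circulation w C ≠ 0 := by
  classical
  refine ⟨ComponentTree.exists_isWeightZero par K emb, ?_⟩
  rintro w hw u C hC ⟨N, M, hNM, hN, hM⟩
  obtain ⟨d, hd, rfl⟩ := ComponentTree.exists_mem_of_projection_ne_nil D hN
  obtain ⟨d', hd', rfl⟩ := ComponentTree.exists_mem_of_projection_ne_nil D hM
  rw [hC.circulation_eq]
  convert hw.sum_ne_zero hpar hm hK hC.isCycleDarts (List.mem_toFinset.2 hd)
    (List.mem_toFinset.2 hd') hNM
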